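/- **Setting.** Let $\xi_0\in[2,\omega]$, let $1\le p_1<p_2<\cdots<p_{\xi_0}\le\infty$ be exponents $p_\zeta$ indexed by $\zeta\in[1,\xi_0]$, with $p_\omega=\lim_k p_k$ if $\xi_0=\omega$, and let $0<\theta\le 1/4$. Write $p'$ for the conjugate exponent of $p$ and $\mathbb N=\{1,2,\dots\}$; a condition $\sum_q|c_q|^{p'}\le1$ means $\max_q|c_q|\le1$ if $p'=\infty$. For nonzero $f,g\in c_{00}(\mathbb N)$ write $f<g$ if $\max\operatorname{supp}f<\min\operatorname{supp}g$. The norming set $W\subset c_{00}(\mathbb N)$ is the smallest set, with functionals possibly carrying an order and a size (possibly several), such that: * $\pm e_j^*\in W$ for all $j\in\mathbb N$ (without order or size); * if $d\ge 1$, $f_1<\cdots<f_d$ are in $W$ and $\sum_q|c_q|^{p_{\xi_0}'}\le1$, then $f=\theta\sum_{q=1}^d c_qf_q\in W$ is of order $0$; if $f=\theta\sum_{q=1}^d(1/n)^{1/p_{\xi_0}'}f_q$ with $d\le n$, then $f$ has size $n$ (order-$0$ functionals not of this form have no size); * if $1\le k<\xi_0$, $d\ge 1$, $\sum_q|c_q|^{p_k'}\le1$,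 and $f_1<\cdots<f_d$ in $W$ are each of order strictly smaller than $k$ with a size $s(f_q)$, with $d\le\min\operatorname{supp}f_1$ and $(f_q)_{q=1}^d$ very fast growing, i.e. $(\max\operatorname{supp}f_{q-1})^2<\min\operatorname{supp}f_q$ and $s(f_q)>\max\operatorname{supp}f_{q-1}$ for $q>1$, then $f=\theta\sum_{q=1}^dc_qf_q\in W$ is of order $k$ and size $\min_q s(f_q)$. $X$ is the completion of $c_{00}(\mathbb N)$ under $\|x\|=\sup\{|f(x)|:f\in W\}$. A block sequence is a sequence $x_1<x_2<\cdots$ of nonzero finitely supported vectors; it is normalized if $\|x_j\|=1$ for all $j$. For a block sequence $(x_j)_j$ and $1\le k<\xi_0$, write $\alpha_{<k}\{(x_j)_j\}=0$ if for every (infinite) very fast growing sequence $(f_i)_i$ of functionals in $W$ of order strictly smaller than $k$ and every subsequence $(x_{j_i})_i$ one has $\lim_i|f_i(x_{j_i})|=0$; otherwise write $\alpha_{<k}\{(x_j)_j\}>0$. A basic sequence $(x_i)_i$ generates the basic sequence $(e_i)_i$ as a spreading model if $\|\sum_{i=1}^na_ie_i\|=\lim_{t_1\to\infty}\cdots\lim_{t_n\to\infty}\|\sum_{i=1}^na_ix_{t_i}\|$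 for all $n$ and all scalars $a_1,\dots,a_n$. It generates an $\ell_p$ spreading model if it generates some spreading model equivalent to the unit vector basis of $\ell_p$ (of $c_0$ if $p=\infty$), and it admits an $\ell_p$ spreading model if some subsequence of it generates one. **Proposition.** Let $(x_j)_j$ be a normalized block sequence in $X$. Then $(x_j)_j$ admits an $\ell_{p_\zeta}$ spreading model for some $\zeta\in[1,\xi_0]$. Moreover: * (a) For $2\le k<\xi_0$ the following are equivalent: (i) $\alpha_{<k}\{(x_j)_j\}>0$ and $\alpha_{<k'}\{(x_j)_j\}=0$ for $1\le k'<k$; (ii) some subsequence of $(x_j)_j$ generates an $\ell_{p_k}$ spreading model, while no subsequence of $(x_j)_j$ generates an $\ell_{p_{k'}}$ spreading model for $1\le k'<k$. * (b) $\alpha_{<1}\{(x_j)_j\}>0$ if and only if some subsequence of $(x_j)_j$ generates an $\ell_{p_1}$ spreading model. * (c) The following are equivalent: (i) $\alpha_{<k}\{(x_j)_j\}=0$ for every $1\le k<\xi_0$; (ii) every subsequence of $(x_j)_j$ has a further subsequence generating an $\ell_{p_{\xi_0}}$ spreading model. If $\xi_0=k_0+1$ is finite, then (c)(i) is equivalent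 to $\alpha_{<k_0}\{(x_j)_j\}=0$. -/

import Mathlib

open Filter Topology
open scoped ENNReal

/-- The data from which the space is built: `ξ₀ ∈ [2, ω]` (with `ω` written `⊤ : ℕ∞`), exponents
`1 ≤ p 1 < p 2 < ⋯ < p ξ₀ ≤ ∞` indexed by `[1, ξ₀]`, with `p ω = lim p k` if `ξ₀ = ω`, and
`0 < θ ≤ 1/4`.  The values of `p` outside `[1, ξ₀]` are irrelevant. -/
structure SpaceData where
  ξ₀ : ℕ∞
  two_le_ξ₀ : 2 ≤ ξ₀
  p : ℕ∞ → ℝ≥0∞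
  one_le_p : 1 ≤ p 1
  p_strictMonoOn : StrictMonoOn p (Set.Icc 1 ξ₀)
  p_tendsto : ξ₀ = ⊤ → Tendsto (fun k : ℕ => p k) atTop (𝓝 (p ⊤))
  θ : ℝ
  θ_pos : 0 < θ
  θ_le : θ ≤ 1 / 4

namespace SpaceData

/-! ### Finitely supported vectors and functionals on `ℕ = {1, 2, …}` -/

/-- `f_1 < f_2 < ⋯`: nonzero vectors with `max supp f_q < min supp f_{q'}` for `q < q'`. -/
def Successive {ι : Type} [LinearOrder ι] (f : ι → ℕ+ →₀ ℝ) : Prop :=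
  (∀ q, f q ≠ 0) ∧
    ∀ q q', q < q' → ∀ i ∈ (f q).support, ∀ j ∈ (f q').support, i < j

/-- `f_1 < ⋯ < f_d` with `d ≤ min supp f_1`. -/
def Admissible {d : ℕ} (f : Fin d → ℕ+ →₀ ℝ) : Prop :=
  Successive f ∧ ∀ q, ∀ i ∈ (f q).support, d ≤ (i : ℕ)

/-- Very fast growing sequences of functionals `f q` with sizes `s q`:
`(max supp f_q)² < min supp f_{q'}` and `s_{q'} > max supp f_q` for `q < q'`.  (As the functionals
are nonzero, this is the same as asking it for consecutive indices only.) -/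
def VeryFastGrowing {ι : Type} [LinearOrder ι] (f : ι → ℕ+ →₀ ℝ) (s : ι → ℕ) : Prop :=
  (∀ q, f q ≠ 0) ∧
    ∀ q q', q < q' → ∀ i ∈ (f q).support, (∀ j ∈ (f q').support, i ^ 2 < j) ∧ (i : ℕ) < s q'

/-- `(c_1, …, c_d)` is in the unit ball of `ℓ_r`: `∑ |c_q| ^ r ≤ 1`, and `max |c_q| ≤ 1` if
`r = ∞`. -/
def InUnitBall (r : ℝ≥0∞) {d : ℕ} (c : Fin d → ℝ) : Prop :=
  if r = ∞ then ∀ q, |c q| ≤ 1 else ∑ q, |c q| ^ r.toReal ≤ 1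

/-- What a norming functional may carry: nothing (`± e_j^*`), order `0` without a size
(`orderZero`), or an order `k` together with a size `s` (`sized k s`).  A functional may carry
several labels. -/
inductive Label : Type
  | basis : Label
  | orderZero : Label
  | sized (k s : ℕ) : Label

/-- `P.IsNorming ℓ f`: the functional `f` is in the norming set and carries the label `ℓ`. -/
inductive IsNorming (P : SpaceData) : Label → (ℕ+ →₀ ℝ) → Prop
  | basis (j : ℕ+) (ε : ℝ) (hε : ε = 1 ∨ ε = -1) :
      IsNorming P Label.basis (Finsupp.single j ε)
  | orderZero {d : ℕ} (hd : 0 < d) (f : Fin d → ℕ+ →₀ ℝ) (ℓ : Fin d → Label) (c : Fin d → ℝ)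
      (hf : ∀ q, IsNorming P (ℓ q) (f q))
      (hsucc : Successive f)
      (hc : InUnitBall (P.p P.ξ₀).conjExponent c) :
      IsNorming P Label.orderZero (P.θ • ∑ q, c q • f q)
  | orderZeroSized {d : ℕ} (hd : 0 < d) (f : Fin d → ℕ+ →₀ ℝ) (ℓ : Fin d → Label) (n : ℕ)
      (hf : ∀ q, IsNorming P (ℓ q) (f q))
      (hsucc : Successive f)
      (hdn : d ≤ n) :
      IsNorming P (Label.sized 0 n)
        (P.θ • ∑ q, ((1 / n : ℝ) ^ (1 / (P.p P.ξ₀).conjExponent.toReal)) • f q)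
  | orderPos {d : ℕ} (k : ℕ) (hk : 1 ≤ k) (hkξ : (k : ℕ∞) < P.ξ₀)
      (f : Fin d → ℕ+ →₀ ℝ) (o s : Fin d → ℕ) (c : Fin d → ℝ) (n : ℕ)
      (hf : ∀ q, IsNorming P (Label.sized (o q) (s q)) (f q))
      (ho : ∀ q, o q < k)
      (hadm : Admissible f)
      (hfast : VeryFastGrowing f s)
      (hc : InUnitBall (P.p k).conjExponent c)
      (hn : IsLeast (Set.range s) n) :
      IsNorming P (Label.sized k n) (P.θ • ∑ q, c q • f q)

/-- The norming set `W`. -/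
def normingSet (P : SpaceData) : Set (ℕ+ →₀ ℝ) := {f | ∃ ℓ, P.IsNorming ℓ f}

/-- The action `f(x) = ∑ f_i x_i`. -/
def act (f x : ℕ+ →₀ ℝ) : ℝ := x.sum fun i a => f i * a

/-! ### The norm on `c₀₀` and its completion -/

lemma abs_le_one_of_inUnitBall {r : ℝ≥0∞} {d : ℕ} {c : Fin d → ℝ} (hr : 1 ≤ r) (hc : InUnitBall r c)
    (q : Fin d) : |c q| ≤ 1 := by
  unfold InUnitBall at hc
  split_ifs at hc with h
  · exact hc q
  · have h1 : |c q| ^ r.toReal ≤ 1 :=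
      (Finset.single_le_sum (f := fun q => |c q| ^ r.toReal)
        (fun i _ => Real.rpow_nonneg (abs_nonneg _) _) (Finset.mem_univ q)).trans hc
    have h2 : 0 < r.toReal := ENNReal.toReal_pos (by positivity) h
    by_contra hlt
    exact absurd h1 (not_le.mpr (Real.one_lt_rpow (not_le.mp hlt) h2))

lemma one_le_conjExponent (r : ℝ≥0∞) : 1 ≤ r.conjExponent := le_self_add

lemma abs_sum_le_one {θ : ℝ} (h0 : 0 < θ) (h1 : θ ≤ 1 / 4) {d : ℕ} {f : Fin d → ℕ+ →₀ ℝ}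
    {c : Fin d → ℝ} (hc : ∀ q, |c q| ≤ 1) (hsucc : Successive f) {i : ℕ+}
    (hf : ∀ q, |f q i| ≤ 1) : |(θ • ∑ q, c q • f q) i| ≤ 1 := by
  have key : |(∑ q, c q • f q) i| ≤ 1 := by
    by_cases h : ∃ q, f q i ≠ 0
    · obtain ⟨q, hq⟩ := h
      have hz : ∀ q', q' ≠ q → f q' i = 0 := by
        intro q' hne
        by_contra hq'
        rcases lt_or_gt_of_ne hne with hl | hl
        · exact lt_irrefl _ (hsucc.2 q' q hl i (by simpa using hq') i (by simpa using hq))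
        · exact lt_irrefl _ (hsucc.2 q q' hl i (by simpa using hq) i (by simpa using hq'))
      rw [Finsupp.finsetSum_apply, Finset.sum_eq_single q]
      · rw [Finsupp.smul_apply, smul_eq_mul, abs_mul]
        exact mul_le_one₀ (hc q) (abs_nonneg _) (hf q)
      · intro q' _ hne
        simp [hz q' hne]
      · simp
    · push Not at h
      simp [Finsupp.finsetSum_apply, h]
  rw [Finsupp.smul_apply, smul_eq_mul, abs_mul, abs_of_pos h0]
  exact mul_le_one₀ (by linarith) (abs_nonneg _) key

lemma abs_apply_le_one {P : SpaceData} {ℓ : Label} {f : ℕ+ →₀ ℝ} (hf : P.IsNorming ℓ f)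
    (i : ℕ+) : |f i| ≤ 1 := by
  induction hf with
  | basis j ε hε =>
    rw [Finsupp.single_apply]
    split_ifs
    · rcases hε with rfl | rfl <;> simp
    · simp
  | orderZero hd f ℓ c hf hsucc hc ih =>
    exact abs_sum_le_one P.θ_pos P.θ_le (abs_le_one_of_inUnitBall (one_le_conjExponent _) hc) hsucc ih
  | orderZeroSized hd f ℓ n hf hsucc hdn ih =>
    refine abs_sum_le_one P.θ_pos P.θ_le (fun q => ?_) hsucc ih
    have hn : (1 : ℝ) ≤ n := by exact_mod_cast hd.trans_le hdn
    rw [abs_of_nonneg (by positivity)]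
    exact Real.rpow_le_one (by positivity) (by rw [div_le_one (by linarith)]; exact hn)
      (by positivity)
  | orderPos k hk hkξ f o s c n hf ho hadm hfast hc hn ih =>
    exact abs_sum_le_one P.θ_pos P.θ_le (abs_le_one_of_inUnitBall (one_le_conjExponent _) hc) hadm.1 ih

lemma single_mem_normingSet (P : SpaceData) (j : ℕ+) :
    Finsupp.single j (1 : ℝ) ∈ P.normingSet :=
  ⟨Label.basis, IsNorming.basis j 1 (Or.inl rfl)⟩

lemma act_add (f x y : ℕ+ →₀ ℝ) : act f (x + y) = act f x + act f y :=
  Finsupp.sum_add_index' (by simp) (by intros; ring)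

lemma act_smul (f : ℕ+ →₀ ℝ) (a : ℝ) (x : ℕ+ →₀ ℝ) : act f (a • x) = a * act f x := by
  unfold act
  rw [Finsupp.sum_smul_index' (by simp), Finsupp.sum, Finsupp.sum, Finset.mul_sum]
  exact Finset.sum_congr rfl fun i _ => by simp; ring

lemma act_single (j : ℕ+) (x : ℕ+ →₀ ℝ) : act (Finsupp.single j 1) x = x j := by
  unfold act Finsupp.sum
  rw [Finset.sum_eq_single j]
  · simp
  · intro i _ hi
    simp [hi.symm]
  · intro h
    simp [Finsupp.notMem_support_iff.mp h]

/-- `c₀₀(ℕ)`, to be normed by `W`. -/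
def C00 (_P : SpaceData) : Type := ℕ+ →₀ ℝ

noncomputable instance (P : SpaceData) : AddCommGroup P.C00 :=
  inferInstanceAs (AddCommGroup (ℕ+ →₀ ℝ))

noncomputable instance (P : SpaceData) : Module ℝ P.C00 :=
  inferInstanceAs (Module ℝ (ℕ+ →₀ ℝ))

/-- `‖x‖ = sup {|f(x)| : f ∈ W}`. -/
noncomputable instance (P : SpaceData) : Norm P.C00 :=
  ⟨fun x => ⨆ f : P.normingSet, |act f.1 x|⟩

lemma norm_def (P : SpaceData) (x : P.C00) : ‖x‖ = ⨆ f : P.normingSet, |act f.1 x| := rfl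

instance (P : SpaceData) : Nonempty P.normingSet := ⟨⟨_, P.single_mem_normingSet 1⟩⟩

lemma bddAbove_act (P : SpaceData) (x : ℕ+ →₀ ℝ) :
    BddAbove (Set.range fun f : P.normingSet => |act f.1 x|) := by
  refine ⟨∑ i ∈ x.support, |x i|, ?_⟩
  rintro _ ⟨⟨f, ℓ, hf⟩, rfl⟩
  refine (Finset.abs_sum_le_sum_abs _ _).trans (Finset.sum_le_sum fun i _ => ?_)
  rw [abs_mul]
  exact mul_le_of_le_one_left (abs_nonneg _) (abs_apply_le_one hf i)

lemma abs_act_le_norm (P : SpaceData) {f : ℕ+ →₀ ℝ} (hf : f ∈ P.normingSet) (x : P.C00) :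
    |act f x| ≤ ‖x‖ :=
  le_ciSup (P.bddAbove_act x) ⟨f, hf⟩

lemma normCore (P : SpaceData) : NormedSpace.Core ℝ P.C00 where
  norm_nonneg x := Real.iSup_nonneg fun _ => abs_nonneg _
  norm_smul a x := by
    rw [norm_def, norm_def, Real.norm_eq_abs, Real.mul_iSup_of_nonneg (abs_nonneg a)]
    refine iSup_congr fun f => ?_
    rw [← abs_mul]
    exact congrArg _ (act_smul f.1 a x)
  norm_triangle x y := ciSup_le fun f => by
    have h : act f.1 (x + y) = act f.1 x + act f.1 y := act_add f.1 x y
    rw [h]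
    exact (abs_add_le _ _).trans
      (add_le_add (P.abs_act_le_norm f.2 x) (P.abs_act_le_norm f.2 y))
  norm_eq_zero_iff x := by
    constructor
    · intro h
      refine Finsupp.ext fun j => ?_
      have h1 : |act (Finsupp.single j 1) x| ≤ ‖x‖ :=
        P.abs_act_le_norm (P.single_mem_normingSet j) x
      have h2 : act (Finsupp.single j 1) x = (show ℕ+ →₀ ℝ from x) j := act_single j x
      rw [h2, h] at h1
      exact abs_nonpos_iff.mp h1
    · rintro rfl
      rw [norm_def]
      have h : ∀ f : P.normingSet, act f.1 (0 : P.C00) = 0 := fun f => Finsupp.sum_zero_index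
      simp [h]

noncomputable instance (P : SpaceData) : NormedAddCommGroup P.C00 :=
  NormedAddCommGroup.ofCore P.normCore

noncomputable instance (P : SpaceData) : NormedSpace ℝ P.C00 :=
  NormedSpace.ofCore P.normCore

/-- The Banach space `X`, the completion of `c₀₀(ℕ)`. -/
abbrev X (P : SpaceData) : Type := UniformSpace.Completion P.C00

/-- `x` is a normalized block sequence in `X`, its terms being the finitely supported vectors
`u j`. -/
def IsNormalizedBlock (P : SpaceData) (u : ℕ → P.C00) (x : ℕ → P.X) : Prop :=
  (∀ j, x j = (u j : P.X)) ∧ Successive (fun j => (u j : ℕ+ →₀ ℝ)) ∧ ∀ j, ‖x j‖ = 1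

/-- `α_{<k}{(u_j)_j} = 0`: for every very fast growing sequence `(f_i)` in `W` of functionals of
order strictly smaller than `k`, and every subsequence `(u_{φ i})`, `lim |f_i (u_{φ i})| = 0`. -/
def AlphaIndexZero (P : SpaceData) (k : ℕ) (u : ℕ → P.C00) : Prop :=
  ∀ (f : ℕ → ℕ+ →₀ ℝ) (o s : ℕ → ℕ),
    (∀ q, P.IsNorming (Label.sized (o q) (s q)) (f q)) → (∀ q, o q < k) →
    VeryFastGrowing f s →
    ∀ φ : ℕ → ℕ, StrictMono φ → Tendsto (fun i => |act (f i) (u (φ i))|) atTop (𝓝 0)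

/-- `α_{<k}{(u_j)_j} > 0`. -/
def AlphaIndexPos (P : SpaceData) (k : ℕ) (u : ℕ → P.C00) : Prop := ¬ P.AlphaIndexZero k u

end SpaceData

/-! ### Basic sequences and spreading models -/

/-- A basic sequence: a Schauder basis of its closed linear span. -/
def IsBasicSequence {E : Type*} [NormedAddCommGroup E] [NormedSpace ℝ E] (e : ℕ → E) : Prop :=
  ∃ b : SchauderBasis ℝ (Submodule.span ℝ (Set.range e)).topologicalClosure,
    ∀ n, (b n : E) = e n

/-- The iterated limit `lim_{t_1 → ∞} ⋯ lim_{t_n → ∞} g (t_1, …, t_n)` exists and equals `L`. -/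
def IteratedLim : (n : ℕ) → ((Fin n → ℕ) → ℝ) → ℝ → Prop
  | 0, g, L => g Fin.elim0 = L
  | n + 1, g, L => ∃ h : ℕ → ℝ,
      (∀ᶠ t in atTop, IteratedLim n (fun s => g (Fin.cons t s)) (h t)) ∧ Tendsto h atTop (𝓝 L)

/-- The basic sequence `(e_i)` is a spreading model of the basic sequence `(x_i)`, i.e. it is
generated by `(x_i)`. -/
def IsSpreadingModel {E F : Type*} [NormedAddCommGroup E] [NormedSpace ℝ E]
    [NormedAddCommGroup F] [NormedSpace ℝ F] (e : ℕ → E) (x : ℕ → F) : Prop :=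
  IsBasicSequence e ∧ IsBasicSequence x ∧
    ∀ (n : ℕ) (a : Fin n → ℝ),
      IteratedLim n (fun t => ‖∑ i, a i • x (t i)‖) ‖∑ i : Fin n, a i • e i‖

/-- Equivalence of sequences: `C`-equivalence for some `C ≥ 1`. -/
def SeqEquivalent {E F : Type*} [AddCommGroup E] [Module ℝ E] [Norm E]
    [AddCommGroup F] [Module ℝ F] [Norm F] (x : ℕ → E) (y : ℕ → F) : Prop :=
  ∃ C : ℝ, 1 ≤ C ∧ ∀ (n : ℕ) (a : Fin n → ℝ),
    (√C)⁻¹ * ‖∑ i, a i • x i‖ ≤ ‖∑ i, a i • y i‖ ∧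
      ‖∑ i, a i • y i‖ ≤ √C * ‖∑ i, a i • x i‖

/-- The unit vector basis of `ℓ_p` (of `c₀ ⊆ ℓ_∞` if `p = ∞`). -/
noncomputable def lpUnitVector (p : ℝ≥0∞) (i : ℕ) : lp (fun _ : ℕ => ℝ) p := lp.single p i 1

/-- `(x_i)` generates an `ℓ_p` spreading model: some spreading model of `(x_i)`, in some Banach
space, is equivalent to the unit vector basis of `ℓ_p`. -/
def GeneratesLp {F : Type*} [NormedAddCommGroup F] [NormedSpace ℝ F] (p : ℝ≥0∞) (x : ℕ → F) :
    Prop :=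
  ∃ (E : Type) (_ : NormedAddCommGroup E) (_ : NormedSpace ℝ E) (_ : CompleteSpace E)
    (e : ℕ → E), IsSpreadingModel e x ∧ SeqEquivalent e (lpUnitVector p)

/-- Some subsequence of `(x_i)` generates an `ℓ_p` spreading model. -/
def HasSubseqGeneratingLp {F : Type*} [NormedAddCommGroup F] [NormedSpace ℝ F] (p : ℝ≥0∞)
    (x : ℕ → F) : Prop :=
  ∃ φ : ℕ → ℕ, StrictMono φ ∧ GeneratesLp p (x ∘ φ)

/-! Every spreading model of a subsequence of a normalized block sequence is squeezed between two
`ℓ_p` estimates, and the indices `α_{<k}` decide which exponents occur.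

Lower estimates come from combining functionals. Each `u j` is almost normed by a functional
supported inside its support, and order-zero combinations of these give a lower `ℓ_{p_{ξ₀}}`
estimate with constant `θ/2` (`lower_estimate`). If `α_{<k} > 0`, some subsequence is acted on
uniformly by a very fast growing sequence of functionals of order below `k`. Their combinations have
order `k`, which gives a lower `ℓ_{p_k}` estimate in every spreading model of that subsequence
(`exists_spreadingModel_lower`). Both arguments use that `W` is closed under restriction to subsets,
without loss of order or size (`IsNorming.filter`).

Upper estimates come from induction over `W`. If `α_{<k} = 0` for all `k < K`, then along a sparse
subsequence functionals of order `o` with `o + 1 < K` and large size are negligible, and every `f ∈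
W` satisfies `|f(∑ a_i v_i)| ≤ 4 ‖a‖_{p_K}` when the index set is small compared with its minimum
(`upper_estimate`). A functional of order zero or of order `k ≥ K` is treated by Hölder's inequality
(`split_estimate`). In a functional of order `k < K` essentially one component matters beyond the
first vector (`fast_estimate`). For `ξ₀ = ω` one lets `K → ∞`.

Spreading models exist after passing to a subsequence (`exists_subseq_iteratedLim`,
`exists_isSpreadingModel`). At the least `k` with `α_{<k} > 0` both estimates hold with exponent
`p_k`. If there is no such `k < ξ₀`, they hold with `p_{ξ₀}`. The equivalences follow because, on
constant vectors, the `ℓ_p` norms for distinct `p` are not comparable up to a constant. -/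

/-! ### The `ℓ_r` norm of a finite family -/

/-- The `ℓ_r` norm of the family `(a i)_{i ∈ s}`. -/
noncomputable def finLpNorm {ι : Type*} (r : ℝ≥0∞) (s : Finset ι) (a : ι → ℝ) : ℝ :=
  if r = ∞ then ((s.sup fun i => ‖a i‖₊ : NNReal) : ℝ)
  else (∑ i ∈ s, |a i| ^ r.toReal) ^ (1 / r.toReal)

namespace finLpNorm

variable {ι κ : Type*} {r p q : ℝ≥0∞} {s t : Finset ι} {a b : ι → ℝ}

lemma toReal_ge_one (hr : 1 ≤ r) (h : r ≠ ∞) : 1 ≤ r.toReal := by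
  simpa using ENNReal.toReal_mono h hr

lemma nonneg (r : ℝ≥0∞) (s : Finset ι) (a : ι → ℝ) : 0 ≤ finLpNorm r s a := by
  unfold finLpNorm
  split_ifs
  · exact NNReal.coe_nonneg _
  · positivity

lemma top_le_iff {M : ℝ} (hM : 0 ≤ M) : finLpNorm ∞ s a ≤ M ↔ ∀ i ∈ s, |a i| ≤ M := by
  lift M to NNReal using hM
  simp only [finLpNorm, if_true, NNReal.coe_le_coe, Finset.sup_le_iff]
  refine forall₂_congr fun i _ => ?_
  rw [← NNReal.coe_le_coe, coe_nnnorm, Real.norm_eq_abs]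

lemma rpow_eq (hr : 1 ≤ r) (h : r ≠ ∞) :
    finLpNorm r s a ^ r.toReal = ∑ i ∈ s, |a i| ^ r.toReal := by
  have h1 := toReal_ge_one hr h
  rw [finLpNorm, if_neg h, one_div, Real.rpow_inv_rpow (by positivity) (by linarith)]

lemma le_iff {M : ℝ} (hM : 0 ≤ M) (hr : 1 ≤ r) (h : r ≠ ∞) :
    finLpNorm r s a ≤ M ↔ ∑ i ∈ s, |a i| ^ r.toReal ≤ M ^ r.toReal := by
  have h1 := toReal_ge_one hr h
  rw [← rpow_eq hr h, Real.rpow_le_rpow_iff (nonneg _ _ _) hM (by linarith)]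

lemma abs_le (hr : 1 ≤ r) {i : ι} (hi : i ∈ s) : |a i| ≤ finLpNorm r s a := by
  by_cases h : r = ∞
  · subst h
    exact (top_le_iff (nonneg _ _ _)).mp le_rfl i hi
  · have h1 := toReal_ge_one hr h
    rw [← Real.rpow_le_rpow_iff (abs_nonneg _) (nonneg _ _ _) (by linarith : 0 < r.toReal),
      rpow_eq hr h]
    exact Finset.single_le_sum (f := fun i => |a i| ^ r.toReal) (fun i _ => by positivity) hi

lemma mono (hr : 1 ≤ r) (hst : s ⊆ t) (hab : ∀ i ∈ s, |a i| ≤ |b i|) :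
    finLpNorm r s a ≤ finLpNorm r t b := by
  by_cases h : r = ∞
  · subst h
    exact (top_le_iff (nonneg _ _ _)).mpr fun i hi => (hab i hi).trans (abs_le hr (hst hi))
  · have h1 := toReal_ge_one hr h
    rw [le_iff (nonneg _ _ _) hr h, rpow_eq hr h]
    exact (Finset.sum_le_sum fun i hi =>
      Real.rpow_le_rpow (abs_nonneg _) (hab i hi) (by linarith)).trans
      (Finset.sum_le_sum_of_subset_of_nonneg hst fun i _ _ => by positivity)

lemma mul_left (hr : 1 ≤ r) (c : ℝ) :
    finLpNorm r s (fun i => c * a i) = |c| * finLpNorm r s a := by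
  by_cases h : r = ∞
  · subst h
    simp only [finLpNorm, if_true, nnnorm_mul, ← NNReal.mul_finset_sup, NNReal.coe_mul]
    simp
  · have h1 := toReal_ge_one hr h
    rw [finLpNorm, finLpNorm, if_neg h, if_neg h]
    simp_rw [abs_mul, Real.mul_rpow (abs_nonneg _) (abs_nonneg _)]
    rw [← Finset.mul_sum, Real.mul_rpow (by positivity) (by positivity), one_div,
      Real.rpow_rpow_inv (abs_nonneg _) (by linarith)]

lemma empty (hr : 1 ≤ r) (a : ι → ℝ) : finLpNorm r ∅ a = 0 := by
  by_cases h : r = ∞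
  · simp [finLpNorm, h]
  · have := toReal_ge_one hr h
    simp [finLpNorm, h, Real.zero_rpow (show r.toReal⁻¹ ≠ 0 by positivity)]

lemma map (e : κ ↪ ι) (s : Finset κ) (a : ι → ℝ) :
    finLpNorm r (s.map e) a = finLpNorm r s (fun k => a (e k)) := by
  unfold finLpNorm
  rw [Finset.sup_map, Finset.sum_map]
  rfl

lemma antitone (hp : 1 ≤ p) (hpq : p ≤ q) : finLpNorm q s a ≤ finLpNorm p s a := by
  by_cases hq : q = ∞
  · subst hq
    exact (top_le_iff (nonneg _ _ _)).mpr fun i hi => abs_le hp hi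
  have hp' : p ≠ ∞ := ne_top_of_le_ne_top hq hpq
  have h1 := toReal_ge_one hp hp'
  have h2 : p.toReal ≤ q.toReal := ENNReal.toReal_mono hq hpq
  have hM := nonneg p s a
  rw [le_iff hM (hp.trans hpq) hq]
  have e1 : ∀ x : ℝ, 0 ≤ x → x ^ q.toReal = x ^ p.toReal * x ^ (q.toReal - p.toReal) := by
    intro x hx
    rw [← Real.rpow_add_of_nonneg hx (by linarith) (by linarith)]
    congr 1
    ring
  rw [e1 _ hM, rpow_eq hp hp', Finset.sum_mul]
  refine Finset.sum_le_sum fun i hi => ?_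
  rw [e1 _ (abs_nonneg _)]
  gcongr
  exact abs_le hp hi

lemma one_eq : finLpNorm 1 s a = ∑ i ∈ s, |a i| := by
  simp [finLpNorm]

lemma conjExponent_top : (∞ : ℝ≥0∞).conjExponent = 1 := by simp [ENNReal.conjExponent]

lemma conjExponent_one : (1 : ℝ≥0∞).conjExponent = ∞ := by simp [ENNReal.conjExponent]

lemma conjExponent_ne_top (hp : 1 < p) : p.conjExponent ≠ ∞ := by
  simp [ENNReal.conjExponent, tsub_eq_zero_iff_le, hp]

lemma conjExponent_antitone (hpq : p ≤ q) : q.conjExponent ≤ p.conjExponent := by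
  unfold ENNReal.conjExponent
  gcongr

lemma holderConjugate_toReal (hp : 1 < p) (hp' : p ≠ ∞) :
    p.toReal.HolderConjugate p.conjExponent.toReal := by
  have := ENNReal.HolderConjugate.conjExponent hp.le
  exact ENNReal.HolderConjugate.toReal (p := p) (q := p.conjExponent)
    (by simpa using (ENNReal.toReal_lt_toReal (by simp) hp').mpr hp)

lemma holder (hp : 1 ≤ p) :
    ∑ i ∈ s, |a i| * |b i| ≤ finLpNorm p s a * finLpNorm p.conjExponent s b := by
  rcases hp.eq_or_lt with rfl | hp1
  · rw [conjExponent_one, one_eq, Finset.sum_mul]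
    refine Finset.sum_le_sum fun i hi => ?_
    gcongr
    exact abs_le le_top hi
  by_cases hp' : p = ∞
  · subst hp'
    rw [conjExponent_top, one_eq, Finset.mul_sum]
    refine Finset.sum_le_sum fun i hi => ?_
    gcongr
    exact abs_le le_top hi
  have h := Real.inner_le_Lp_mul_Lq s (fun i => |a i|) (fun i => |b i|)
    (holderConjugate_toReal hp1 hp')
  rw [finLpNorm, finLpNorm, if_neg hp', if_neg (conjExponent_ne_top hp1)]
  simpa using h

/-- The extremal case of Hölder's inequality. It supplies the coefficients of the functional that
witnesses a lower `ℓ_p` estimate. -/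
lemma exists_dual (hp : 1 ≤ p) (s : Finset ι) (a : ι → ℝ) :
    ∃ c : ι → ℝ, finLpNorm p.conjExponent s c ≤ 1 ∧
      ∑ i ∈ s, c i * a i = finLpNorm p s a := by
  classical
  have hsign : ∀ x : ℝ, (SignType.sign x : ℝ) * x = |x| := sign_mul_self
  have hsign1 : ∀ x : ℝ, |(SignType.sign x : ℝ)| ≤ 1 := by
    intro x
    rcases lt_trichotomy x 0 with h | h | h <;> simp [h]
  rcases hp.eq_or_lt with rfl | hp1
  · refine ⟨fun i => SignType.sign (a i), ?_, ?_⟩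
    · rw [conjExponent_one]
      exact (top_le_iff zero_le_one).mpr fun i _ => hsign1 _
    · simp [one_eq, hsign]
  by_cases hp' : p = ∞
  · subst hp'
    rcases s.eq_empty_or_nonempty with rfl | hs
    · exact ⟨0, by simp [conjExponent_top, one_eq], by simp [finLpNorm]⟩
    obtain ⟨j, hj, hmax⟩ := Finset.exists_max_image s (fun i => |a i|) hs
    refine ⟨fun i => if i = j then SignType.sign (a i) else 0, ?_, ?_⟩
    · rw [conjExponent_top, one_eq]
      simp only [apply_ite abs, abs_zero, Finset.sum_ite_eq', hj, if_true]
      exact hsign1 _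
    · simp only [ite_mul, zero_mul, Finset.sum_ite_eq', hj, if_true, hsign]
      exact le_antisymm (abs_le hp hj) ((top_le_iff (abs_nonneg _)).mpr hmax)
  have hconj := holderConjugate_toReal hp1 hp'
  obtain ⟨⟨g, hg, hgs⟩, -⟩ := NNReal.isGreatest_Lp s (fun i => ‖a i‖₊) hconj
  refine ⟨fun i => SignType.sign (a i) * g i, ?_, ?_⟩
  · rw [le_iff zero_le_one (SpaceData.one_le_conjExponent _) (conjExponent_ne_top hp1), Real.one_rpow]
    have hg' : ∑ i ∈ s, (g i : ℝ) ^ p.conjExponent.toReal ≤ 1 := by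
      exact_mod_cast NNReal.coe_le_coe.mpr hg
    refine le_trans (Finset.sum_le_sum fun i _ => ?_) hg'
    refine Real.rpow_le_rpow (abs_nonneg _) ?_ ENNReal.toReal_nonneg
    rw [abs_mul, NNReal.abs_eq]
    exact mul_le_of_le_one_left (NNReal.coe_nonneg _) (hsign1 _)
  · rw [finLpNorm, if_neg hp']
    have := congrArg (fun x : NNReal => (x : ℝ)) hgs
    push_cast at this
    simp only [Real.norm_eq_abs] at this
    rw [← this]
    refine Finset.sum_congr rfl fun i _ => ?_
    rw [mul_right_comm, hsign]

/-- The tool for recombining pieces in the upper estimate. It is applied both to the coefficients of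
a functional and to those of a vector. -/
lemma disjoint_pieces (hr : 1 ≤ r) {S : Finset κ} {A : κ → Finset ι} (hA : ∀ k ∈ S, A k ⊆ t)
    (hdisj : (S : Set κ).PairwiseDisjoint A) :
    finLpNorm r S (fun k => finLpNorm r (A k) a) ≤ finLpNorm r t a := by
  classical
  by_cases h : r = ∞
  · subst h
    refine (top_le_iff (nonneg _ _ _)).mpr fun k hk => ?_
    rw [abs_of_nonneg (nonneg _ _ _)]
    exact mono le_top (hA k hk) fun _ _ => le_rfl
  · rw [le_iff (nonneg _ _ _) hr h, rpow_eq hr h]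
    simp_rw [abs_of_nonneg (nonneg _ _ _), rpow_eq hr h]
    rw [← Finset.sum_biUnion hdisj]
    exact Finset.sum_le_sum_of_subset_of_nonneg (Finset.biUnion_subset.mpr hA)
      fun i _ _ => by positivity

/-- Convexity of `t ↦ t ^ (q / p)`. The exponents are taken as `p⁻¹.toReal` and `q⁻¹.toReal` so that
`∞` contributes `0`; this is what allows `p_k → p_ω` even when `p_ω = ∞`. -/
lemma le_card_rpow_mul (hp : 1 ≤ p) (hpq : p ≤ q) :
    finLpNorm p s a ≤ (s.card : ℝ) ^ (p⁻¹.toReal - q⁻¹.toReal) * finLpNorm q s a := by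
  by_cases hp' : p = ∞
  · subst hp'
    simp [_root_.top_le_iff.mp hpq]
  have h1 := toReal_ge_one hp hp'
  rw [ENNReal.toReal_inv, ENNReal.toReal_inv]
  have hcard : (0 : ℝ) ≤ s.card := Nat.cast_nonneg _
  have hM := nonneg q s a
  by_cases hq : q = ∞
  · subst hq
    rw [le_iff (by positivity) hp hp', Real.mul_rpow (by positivity) hM, ENNReal.toReal_top,
      inv_zero, sub_zero, Real.rpow_inv_rpow hcard (by linarith)]
    calc ∑ i ∈ s, |a i| ^ p.toReal ≤ ∑ i ∈ s, finLpNorm ∞ s a ^ p.toReal :=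
          Finset.sum_le_sum fun i hi =>
            Real.rpow_le_rpow (abs_nonneg _) (abs_le le_top hi) (by linarith)
      _ = _ := by simp
  have h2 : p.toReal ≤ q.toReal := ENNReal.toReal_mono hq hpq
  have hp0 : 0 < p.toReal := by linarith
  have hq0 : 0 < q.toReal := by linarith
  have h3 : 1 ≤ q.toReal / p.toReal := (one_le_div hp0).mpr h2
  have key := Real.rpow_sum_le_const_mul_sum_rpow s (fun i => |a i| ^ p.toReal) h3
  have e : ∀ i, |(|a i| ^ p.toReal)| ^ (q.toReal / p.toReal) = |a i| ^ q.toReal := fun i => by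
    rw [abs_of_nonneg (by positivity), ← Real.rpow_mul (abs_nonneg _)]
    congr 1
    field_simp
  simp_rw [e, ← rpow_eq (hp.trans hpq) hq] at key
  have e2 : ∑ i ∈ s, |(|a i| ^ p.toReal)| = finLpNorm p s a ^ p.toReal := by
    rw [rpow_eq hp hp']
    exact Finset.sum_congr rfl fun i _ => abs_of_nonneg (by positivity)
  rw [e2, ← Real.rpow_mul (nonneg _ _ _), mul_div_cancel₀ _ hp0.ne'] at key
  rw [← Real.rpow_le_rpow_iff (nonneg _ _ _) (by positivity) hq0,
    Real.mul_rpow (by positivity) hM, ← Real.rpow_mul hcard]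
  convert key using 3
  field_simp

lemma const_one (hr : 1 ≤ r) (hs : s.Nonempty) :
    finLpNorm r s (fun _ => 1) = (s.card : ℝ) ^ r⁻¹.toReal := by
  by_cases h : r = ∞
  · subst h
    simp [finLpNorm, Finset.sup_const hs]
  · simp [finLpNorm, h, ENNReal.toReal_inv]

lemma norm_sum_lpUnitVector (hr : 1 ≤ r) (n : ℕ) (a : Fin n → ℝ) :
    ‖∑ i, a i • lpUnitVector r i‖ = finLpNorm r Finset.univ a := by
  by_cases h : r = ∞
  · subst h
    have hval : ∀ m : ℕ, (↑(∑ i, a i • lpUnitVector ∞ i) : ℕ → ℝ) m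
        = if hm : m < n then a ⟨m, hm⟩ else 0 := by
      intro m
      simp only [lp.coeFn_sum, Finset.sum_apply, lp.coeFn_smul, Pi.smul_apply, lpUnitVector,
        lp.coeFn_single, smul_eq_mul, Pi.single_apply, mul_ite, mul_one, mul_zero]
      split_ifs with hm
      · rw [Finset.sum_eq_single ⟨m, hm⟩]
        · simp
        · intro i _ hi
          rw [if_neg]
          rintro rfl
          exact hi rfl
        · simp
      · refine Finset.sum_eq_zero fun i _ => if_neg ?_
        rintro rfl
        exact hm i.2
    refine le_antisymm ?_ ?_
    · refine lp.norm_le_of_forall_le (nonneg _ _ _) fun m => ?_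
      rw [hval]
      split_ifs with hm
      · exact abs_le le_top (Finset.mem_univ _)
      · simpa using nonneg _ _ _
    · refine (top_le_iff (norm_nonneg _)).mpr fun i _ => ?_
      have := lp.norm_apply_le_norm (by simp) (∑ i, a i • lpUnitVector ∞ i) (i : ℕ)
      rw [hval] at this
      simpa using this
  · have h1 := toReal_ge_one hr h
    rw [← Real.rpow_left_inj (lp.norm_nonneg' _) (nonneg _ _ _) (by linarith : r.toReal ≠ 0),
      rpow_eq hr h]
    have := lp.norm_sum_single (E := fun _ : ℕ => ℝ) (p := r) (by linarith)
      (fun m => if hm : m < n then a ⟨m, hm⟩ else 0) (Finset.range n)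
    rw [← Fin.sum_univ_eq_sum_range
      (fun m => lp.single r m (if hm : m < n then a ⟨m, hm⟩ else 0)) n,
      ← Fin.sum_univ_eq_sum_range
      (fun m => ‖(if hm : m < n then a ⟨m, hm⟩ else 0)‖ ^ r.toReal) n] at this
    simp only [Fin.is_lt, dite_true, Fin.eta, Real.norm_eq_abs] at this
    rw [← this]
    congr 3 with i
    rw [lpUnitVector, ← lp.single_smul]
    simp

end finLpNorm

lemma SpaceData.inUnitBall_iff {r : ℝ≥0∞} (hr : 1 ≤ r) {d : ℕ} {c : Fin d → ℝ} :
    InUnitBall r c ↔ finLpNorm r Finset.univ c ≤ 1 := by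
  unfold InUnitBall
  split_ifs with h
  · subst h
    rw [finLpNorm.top_le_iff zero_le_one]
    simp
  · rw [finLpNorm.le_iff zero_le_one hr h, Real.one_rpow]

/-! ### Iterated limits -/

namespace IteratedLim

lemma const (n : ℕ) (c : ℝ) : IteratedLim n (fun _ => c) c := by
  induction n with
  | zero => rfl
  | succ n ih => exact ⟨fun _ => c, Eventually.of_forall fun _ => ih, tendsto_const_nhds⟩

lemma add {n : ℕ} {g g' : (Fin n → ℕ) → ℝ} {l l' : ℝ} (h : IteratedLim n g l)
    (h' : IteratedLim n g' l') : IteratedLim n (fun t => g t + g' t) (l + l') := by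
  induction n generalizing l l' with
  | zero =>
    simp only [IteratedLim] at h h' ⊢
    rw [h, h']
  | succ n ih =>
    obtain ⟨u, hu, hl⟩ := h
    obtain ⟨u', hu', hl'⟩ := h'
    exact ⟨fun t => u t + u' t, by filter_upwards [hu, hu'] with t h1 h2 using ih h1 h2, hl.add hl'⟩

lemma const_mul {n : ℕ} {g : (Fin n → ℕ) → ℝ} {l : ℝ} (c : ℝ) (h : IteratedLim n g l) :
    IteratedLim n (fun t => c * g t) (c * l) := by
  induction n generalizing l with
  | zero =>
    simp only [IteratedLim] at h ⊢
    rw [h]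
  | succ n ih =>
    obtain ⟨u, hu, hl⟩ := h
    exact ⟨fun t => c * u t, by filter_upwards [hu] with t h1 using ih h1, hl.const_mul c⟩

lemma comp {n : ℕ} {g : (Fin n → ℕ) → ℝ} {l : ℝ} (h : IteratedLim n g l) {φ : ℕ → ℕ}
    (hφ : Tendsto φ atTop atTop) : IteratedLim n (fun t => g (φ ∘ t)) l := by
  induction n generalizing l with
  | zero =>
    simp only [IteratedLim] at h ⊢
    rw [← h]
    exact congrArg g (Subsingleton.elim _ _)
  | succ n ih =>
    obtain ⟨u, hu, hl⟩ := h
    refine ⟨u ∘ φ, ?_, hl.comp hφ⟩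
    filter_upwards [hφ.eventually hu] with t h1
    have := ih h1
    simp only [Fin.comp_cons]
    exact this

/-- Each variable goes to infinity with the earlier ones fixed, so it may be assumed larger than all
of them and than `T`. Hence inequalities valid only for increasing tuples far out, which is all that
block sequences provide, pass to iterated limits. -/
lemma mono {n : ℕ} {g g' : (Fin n → ℕ) → ℝ} {l l' : ℝ} (h : IteratedLim n g l)
    (h' : IteratedLim n g' l') (T : ℕ)
    (hle : ∀ t : Fin n → ℕ, StrictMono t → (∀ i, T ≤ t i) → g t ≤ g' t) : l ≤ l' := by
  induction n generalizing l l' T with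
  | zero =>
    simp only [IteratedLim] at h h'
    rw [← h, ← h']
    exact hle _ (fun i => i.elim0) fun i => i.elim0
  | succ n ih =>
    obtain ⟨u, hu, hl⟩ := h
    obtain ⟨u', hu', hl'⟩ := h'
    refine le_of_tendsto_of_tendsto hl hl' ?_
    filter_upwards [hu, hu', eventually_ge_atTop T] with t h1 h2 hT
    refine ih h1 h2 (t + 1) fun s hs hts => hle _ ?_ ?_
    · intro i j hij
      induction j using Fin.cases with
      | zero => exact absurd hij (Fin.not_lt_zero i)
      | succ j =>
        induction i using Fin.cases with
        | zero => simpa using hts j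
        | succ i => simpa using hs (Fin.succ_lt_succ_iff.mp hij)
    · intro i
      induction i using Fin.cases with
      | zero => simpa using hT
      | succ i => simpa using (by have := hts i; omega : T ≤ s i)

lemma unique {n : ℕ} {g : (Fin n → ℕ) → ℝ} {l l' : ℝ} (h : IteratedLim n g l)
    (h' : IteratedLim n g l') : l = l' :=
  le_antisymm (h.mono h' 0 fun _ _ _ => le_rfl) (h'.mono h 0 fun _ _ _ => le_rfl)

/-- A dummy last variable does not change an iterated limit. This makes the limit norm of a finitely
supported sequence independent of the length used to write it. -/
lemma init {n : ℕ} {g : (Fin n → ℕ) → ℝ} {l : ℝ} (h : IteratedLim n g l) :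
    IteratedLim (n + 1) (fun t => g (Fin.init t)) l := by
  induction n generalizing l with
  | zero =>
    refine ⟨fun _ => l, Eventually.of_forall fun t => ?_, tendsto_const_nhds⟩
    simp only [IteratedLim] at h ⊢
    rw [← h]
    exact congrArg g (Subsingleton.elim _ _)
  | succ n ih =>
    obtain ⟨u, hu, hl⟩ := h
    refine ⟨u, ?_, hl⟩
    filter_upwards [hu] with t h1
    have e : ∀ s : Fin (n + 1) → ℕ,
        Fin.init (Fin.cons t s : Fin (n + 2) → ℕ) = Fin.cons t (Fin.init s) := fun s =>
      funext fun i => by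
        induction i using Fin.cases with
        | zero => rfl
        | succ i => rfl
    simp only [e]
    exact ih h1

end IteratedLim

/-! ### Sequences all of whose norms have iterated limits -/

section IterNorm

variable {F : Type*} [NormedAddCommGroup F] [NormedSpace ℝ F]

/-- `lim_{t_1} ⋯ lim_{t_n} ‖y + ∑ i, a i • x (t_i)‖` along a fixed nonprincipal ultrafilter. -/
noncomputable def iterNorm (x : ℕ → F) : (n : ℕ) → (Fin n → ℝ) → F → ℝ
  | 0, _, y => ‖y‖
  | n + 1, a, y => limUnder (hyperfilter ℕ : Filter ℕ)
      fun t => iterNorm x n (Fin.tail a) (y + a 0 • x t)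

lemma exists_tendsto_hyperfilter {f : ℕ → ℝ} {M : ℝ} (hf : ∀ t, f t ∈ Set.Icc 0 M) :
    ∃ l, Tendsto f (hyperfilter ℕ) (𝓝 l) := by
  obtain ⟨l, -, hl⟩ := isCompact_Icc.ultrafilter_le_nhds ((hyperfilter ℕ).map f)
    (le_principal_iff.mpr (Ultrafilter.mem_coe.mpr (Ultrafilter.mem_map.mpr
      (Filter.univ_mem' (f := (hyperfilter ℕ : Filter ℕ)) hf))))
  exact ⟨l, hl⟩

/-- Convergence at depth `n + 1` rests on the bound at depth `n`, so the properties are proved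
together. The Lipschitz estimate is what later reduces all scalars and vectors to countably many. -/
lemma iterNorm_spec (x : ℕ → F) (hx : ∀ j, ‖x j‖ ≤ 1) (n : ℕ) :
    (∀ a y, iterNorm x n a y ∈ Set.Icc 0 (‖y‖ + ∑ i, |a i|)) ∧
    (∀ a b y z, |iterNorm x n a y - iterNorm x n b z| ≤ ‖y - z‖ + ∑ i, |a i - b i|) ∧
    ∀ (a : Fin (n + 1) → ℝ) y, Tendsto (fun t => iterNorm x n (Fin.tail a) (y + a 0 • x t))
      (hyperfilter ℕ) (𝓝 (iterNorm x (n + 1) a y)) := by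
  have hsm : ∀ (c : ℝ) t, ‖c • x t‖ ≤ |c| := fun c t => by
    rw [norm_smul]
    exact mul_le_of_le_one_right (norm_nonneg _) (hx t)
  have hbd : ∀ n, (∀ a y, iterNorm x n a y ∈ Set.Icc 0 (‖y‖ + ∑ i, |a i|)) →
      ∀ (a : Fin (n + 1) → ℝ) y t, iterNorm x n (Fin.tail a) (y + a 0 • x t) ∈
        Set.Icc 0 (‖y‖ + ∑ i, |a i|) := by
    intro n h a y t
    refine ⟨(h _ _).1, (h _ _).2.trans ?_⟩
    rw [Fin.sum_univ_succ, ← add_assoc]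
    have := norm_add_le y (a 0 • x t)
    have := hsm (a 0) t
    simp only [Fin.tail]
    linarith
  have hlim : ∀ n, (∀ a y, iterNorm x n a y ∈ Set.Icc 0 (‖y‖ + ∑ i, |a i|)) →
      ∀ (a : Fin (n + 1) → ℝ) y, Tendsto
        (fun t => iterNorm x n (Fin.tail a) (y + a 0 • x t))
        (hyperfilter ℕ) (𝓝 (iterNorm x (n + 1) a y)) := by
    intro n h a y
    exact tendsto_nhds_limUnder (exists_tendsto_hyperfilter (hbd n h a y))
  suffices H : (∀ a y, iterNorm x n a y ∈ Set.Icc 0 (‖y‖ + ∑ i, |a i|)) ∧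
      (∀ a b y z, |iterNorm x n a y - iterNorm x n b z| ≤ ‖y - z‖ + ∑ i, |a i - b i|) from
    ⟨H.1, H.2, hlim n H.1⟩
  induction n with
  | zero =>
    refine ⟨fun a y => ⟨norm_nonneg _, ?_⟩, fun a b y z => ?_⟩
    · simp [iterNorm]
    · simpa [iterNorm] using abs_norm_sub_norm_le y z
  | succ n ih =>
    refine ⟨fun a y => isClosed_Icc.mem_of_tendsto (hlim n ih.1 a y)
      (Eventually.of_forall (hbd n ih.1 a y)), fun a b y z => ?_⟩
    refine le_of_tendsto ((hlim n ih.1 a y).sub (hlim n ih.1 b z)).abs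
      (Eventually.of_forall fun t => (ih.2 _ _ _ _).trans ?_)
    rw [Fin.sum_univ_succ, ← add_assoc]
    have h1 : y + a 0 • x t - (z + b 0 • x t) = (y - z) + (a 0 - b 0) • x t := by
      rw [sub_smul]
      abel
    have := norm_add_le (y - z) ((a 0 - b 0) • x t)
    have := hsm (a 0 - b 0) t
    rw [h1]
    simp only [Fin.tail]
    linarith

lemma exists_rat_vec_near {n : ℕ} (a : Fin n → ℝ) {ε : ℝ} (hε : 0 < ε) :
    ∃ q : Fin n → ℚ, ∑ i, |a i - q i| < ε := by
  have h : ∀ i, ∃ q : ℚ, |a i - q| < ε / (n + 1) := fun i => by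
    obtain ⟨q, hq⟩ := exists_rat_btwn (show a i < a i + ε / (n + 1) by
      have : 0 < ε / (n + 1) := by positivity
      linarith)
    exact ⟨q, by rw [abs_lt]; constructor <;> linarith [hq.1, hq.2]⟩
  choose q hq using h
  refine ⟨q, (Finset.sum_le_sum fun i _ => (hq i).le).trans_lt ?_⟩
  rw [Finset.sum_const, Finset.card_univ, Fintype.card_fin, nsmul_eq_mul, mul_div_assoc',
    div_lt_iff₀ (by positivity)]
  nlinarith

/-- Ultrafilter limits exist for every tuple; the task is to realize them along one subsequence.
Only the outermost variable has to be handled at each depth, since the inner limits are again values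
of `iterNorm`. Rational coefficients and a countable set dense in the span suffice by the Lipschitz
bound. -/
theorem exists_subseq_iteratedLim (x : ℕ → F) (hx : ∀ j, ‖x j‖ ≤ 1) :
    ∃ φ : ℕ → ℕ, StrictMono φ ∧ ∀ (n : ℕ) (a : Fin n → ℝ),
      ∃ l, IteratedLim n (fun t => ‖∑ i, a i • x (φ (t i))‖) l := by
  obtain ⟨D, hD, hsD⟩ := ((Set.countable_range x).isSeparable.span (R := ℝ))
  have : Countable D := hD
  let ι := Σ n : ℕ, (Fin (n + 1) → ℚ) × D
  let H : ℕ → ι → ℝ := fun t i =>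
    iterNorm x i.1 (Fin.tail fun j => (i.2.1 j : ℝ)) (i.2.2 + ((i.2.1 0 : ℚ) : ℝ) • x t)
  have hH : Tendsto H (hyperfilter ℕ)
      (𝓝 fun i => iterNorm x (i.1 + 1) (fun j => (i.2.1 j : ℝ)) i.2.2) :=
    tendsto_pi_nhds.mpr fun i =>
      (iterNorm_spec x hx i.1).2.2 (fun j => (i.2.1 j : ℝ)) i.2.2
  have hle : ((hyperfilter ℕ : Ultrafilter ℕ) : Filter ℕ) ≤ atTop := Nat.hyperfilter_le_atTop
  -- A limit along an ultrafilter finer than `atTop` is a cluster point, and a countable power of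
  -- `ℝ` is first countable, so one subsequence serves all indices at once.
  obtain ⟨φ, hφ, hlim⟩ := (hH.mapClusterPt.mono hle).tendsto_subseq
  have key : ∀ (n : ℕ) (a : Fin (n + 1) → ℝ), ∀ y ∈ Submodule.span ℝ (Set.range x),
      Tendsto (fun t => iterNorm x n (Fin.tail a) (y + a 0 • x (φ t))) atTop
        (𝓝 (iterNorm x (n + 1) a y)) := by
    intro n a y hy
    rw [Metric.tendsto_atTop]
    intro ε hε
    obtain ⟨q, hq⟩ := exists_rat_vec_near a (show 0 < ε / 8 by positivity)
    obtain ⟨d, hd, hyd⟩ := Metric.mem_closure_iff.mp (hsD hy) (ε / 8) (by positivity)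
    obtain ⟨N, hN⟩ := Metric.tendsto_atTop.mp (tendsto_pi_nhds.mp hlim ⟨n, q, ⟨d, hd⟩⟩)
      (ε / 4) (by positivity)
    -- Three errors below `ε / 4` each: replacing `(a, y)` by `(q, d)` in the limit, the same inside
    -- the sequence, and the convergence for `(q, d)`.
    refine ⟨N, fun t ht => ?_⟩
    have h1 := hN t ht
    simp only [Function.comp_apply, H] at h1
    rw [dist_eq_norm] at hyd
    have h2 := (iterNorm_spec x hx (n + 1)).2.1 a (fun j => (q j : ℝ)) y d
    have h3 := (iterNorm_spec x hx n).2.1 (Fin.tail a) (Fin.tail fun j => (q j : ℝ))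
      (y + a 0 • x (φ t)) (d + ((q 0 : ℚ) : ℝ) • x (φ t))
    have h4 : ‖y + a 0 • x (φ t) - (d + ((q 0 : ℚ) : ℝ) • x (φ t))‖ ≤ ‖y - d‖ + |a 0 - q 0| := by
      have e : y + a 0 • x (φ t) - (d + ((q 0 : ℚ) : ℝ) • x (φ t))
          = (y - d) + (a 0 - q 0) • x (φ t) := by
        rw [sub_smul]
        abel
      rw [e]
      refine (norm_add_le _ _).trans ?_
      gcongr
      rw [norm_smul]
      exact mul_le_of_le_one_right (norm_nonneg _) (hx _)
    rw [Fin.sum_univ_succ] at hq h2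
    rw [Real.dist_eq, abs_lt] at h1 ⊢
    rw [abs_le] at h2 h3
    simp only [Fin.tail] at h1 h2 h3 ⊢
    constructor <;> linarith [h1.1, h1.2, h2.1, h2.2, h3.1, h3.2]
  refine ⟨φ, hφ, fun n a => ⟨iterNorm x n a 0, ?_⟩⟩
  suffices h : ∀ y ∈ Submodule.span ℝ (Set.range x),
      IteratedLim n (fun t => ‖y + ∑ i, a i • x (φ (t i))‖) (iterNorm x n a y) by
    simpa using h 0 (Submodule.zero_mem _)
  induction n with
  | zero =>
    intro y _
    simp [IteratedLim, iterNorm]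
  | succ n ih =>
    intro y hy
    refine ⟨fun t => iterNorm x n (Fin.tail a) (y + a 0 • x (φ t)),
      Eventually.of_forall fun t => ?_, key n a y hy⟩
    have := ih (Fin.tail a) (y + a 0 • x (φ t)) (Submodule.add_mem _ hy
      (Submodule.smul_mem _ _ (Submodule.subset_span ⟨_, rfl⟩)))
    convert this using 3 with s
    rw [Fin.sum_univ_succ, add_assoc]
    simp [Fin.tail]

end IterNorm

/-! ### Suppression unconditional sequences -/

/-- Nonzero vectors whose span carries contractive coordinate projections. -/
def IsSuppressionUnconditional {E : Type*} [NormedAddCommGroup E] [NormedSpace ℝ E]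
    (e : ℕ → E) : Prop :=
  (∀ i, e i ≠ 0) ∧ ∀ (A B : Finset ℕ) (a : ℕ → ℝ), A ⊆ B →
    ‖∑ i ∈ A, a i • e i‖ ≤ ‖∑ i ∈ B, a i • e i‖

/-- Suppression bounds the coordinate functionals and makes the partial-sum projections contractive
on the span, hence on its closure. They converge to the identity on the dense span, so they do so on
the closure. -/
theorem IsSuppressionUnconditional.isBasicSequence {E : Type*} [NormedAddCommGroup E]
    [NormedSpace ℝ E] {e : ℕ → E} (he : IsSuppressionUnconditional e) : IsBasicSequence e := by
  obtain ⟨hne, H⟩ := he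
  have hcoef : ∀ (B : Finset ℕ) (a : ℕ → ℝ) i, i ∈ B →
      |a i| * ‖e i‖ ≤ ‖∑ i ∈ B, a i • e i‖ := fun B a i hi => by
    simpa [norm_smul] using H {i} B a (by simpa using hi)
  have hli : LinearIndependent ℝ e := by
    rw [linearIndependent_iff']
    intro s a hs i hi
    have := hcoef s a i hi
    rw [hs, norm_zero] at this
    have h0 : 0 < ‖e i‖ := norm_pos_iff.mpr (hne i)
    exact abs_nonpos_iff.mp (by nlinarith [abs_nonneg (a i)])
  set S := Submodule.span ℝ (Set.range e) with hS
  have hrep : ∀ y ∈ S, ∃ c : ℕ →₀ ℝ, ∑ i ∈ c.support, c i • e i = y := fun y hy =>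
    Finsupp.mem_span_range_iff_exists_finsupp.mp hy
  let b := Module.Basis.span hli
  have hb : ∀ i (c : ℕ →₀ ℝ) (y : S), ∑ j ∈ c.support, c j • e j = y → b.coord i y = c i := by
    intro i c y hy
    have hy' : y = ∑ j ∈ c.support, c j • b j := by
      apply Subtype.ext
      rw [← hy]
      simp [b, Module.Basis.span_apply]
    rw [hy', map_sum]
    simp only [map_smul, Module.Basis.coord_apply, Module.Basis.repr_self, smul_eq_mul,
      Finsupp.single_apply, mul_ite, mul_one, mul_zero, Finset.sum_ite_eq', Finsupp.mem_support_iff]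
    split_ifs with h
    · rfl
    · exact (not_not.mp h).symm
  -- Hahn–Banach extends the coordinates to all of `E`, so that the partial sums become operators `Q
  -- n` on `E` and restrict to the closure without further extension.
  have hg : ∀ i, ∃ g : StrongDual ℝ E, ∀ y : S, g y = b.coord i y := fun i => by
    obtain ⟨g, hg, -⟩ := exists_extension_norm_eq S
      ((b.coord i).mkContinuous (‖e i‖⁻¹) fun y => by
        obtain ⟨c, hc⟩ := hrep y y.2
        rw [hb i c y hc]
        by_cases hi : i ∈ c.support
        · have := hcoef c.support c i hi
          rw [hc] at this
          rw [inv_mul_eq_div, le_div_iff₀ (norm_pos_iff.mpr (hne i))]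
          exact this
        · rw [Finsupp.notMem_support_iff.mp hi, norm_zero]
          positivity)
    exact ⟨g, hg⟩
  choose g hg using hg
  have hgc : ∀ (c : ℕ →₀ ℝ) i, g i (∑ j ∈ c.support, c j • e j) = c i := fun c i => by
    have hmem : ∑ j ∈ c.support, c j • e j ∈ S := Submodule.sum_mem _ fun j _ =>
      Submodule.smul_mem _ _ (Submodule.subset_span ⟨j, rfl⟩)
    rw [hg i ⟨_, hmem⟩]
    exact hb i c _ rfl
  let Q : ℕ → E →L[ℝ] E := fun n => ∑ i ∈ Finset.range n, (g i).smulRight (e i)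
  have hQ : ∀ n y, Q n y = ∑ i ∈ Finset.range n, g i y • e i := fun n y => by
    simp [Q, _root_.sum_apply]
  have hQc : ∀ n (c : ℕ →₀ ℝ), Q n (∑ j ∈ c.support, c j • e j)
      = ∑ i ∈ Finset.range n ∩ c.support, c i • e i := fun n c => by
    rw [hQ]
    simp_rw [hgc]
    refine (Finset.sum_subset Finset.inter_subset_left fun i hi hi' => ?_).symm
    have : c i = 0 := by
      by_contra h
      exact hi' (Finset.mem_inter.mpr ⟨hi, Finsupp.mem_support_iff.mpr h⟩)
    rw [this, zero_smul]
  have hcontr : ∀ n, ∀ y ∈ S.topologicalClosure, ‖Q n y‖ ≤ ‖y‖ := fun n y hy => by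
    have hcl : IsClosed {y : E | ‖Q n y‖ ≤ ‖y‖} :=
      isClosed_le (by fun_prop) (by fun_prop)
    refine closure_minimal (fun z hz => ?_) hcl hy
    obtain ⟨c, rfl⟩ := hrep z hz
    rw [Set.mem_ofPred_eq, hQc]
    exact H _ _ c Finset.inter_subset_right
  refine ⟨{ basis := fun i => ⟨e i, Submodule.le_topologicalClosure _ (Submodule.subset_span ⟨i, rfl⟩)⟩
            coord := fun i => (g i).comp S.topologicalClosure.subtypeL
            ortho := fun i j => ?_
            expansion := fun y => ?_ }, fun n => rfl⟩
  · have h1 := hgc (Finsupp.single j 1) i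
    rw [Finsupp.support_single _ one_ne_zero, Finset.sum_singleton,
      Finsupp.single_eq_same, one_smul] at h1
    simp only [ContinuousLinearMap.comp_apply, Submodule.subtypeL_apply, h1]
    simp [Finsupp.single_apply, Pi.single_apply, eq_comm]
  -- The expansion is summed conditionally, that is, along the initial segments `range n`.
  · rw [HasSum, SummationFilter.conditional_filter_eq_map_range, tendsto_map'_iff,
      tendsto_subtype_rng]
    have hmain : Tendsto (fun n => Q n (y : E)) atTop (𝓝 (y : E)) := by
      rw [Metric.tendsto_atTop]
      intro ε hε
      obtain ⟨z, hz, hyz⟩ := Metric.mem_closure_iff.mp y.2 (ε / 3) (by positivity)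
      obtain ⟨c, rfl⟩ := hrep z hz
      obtain ⟨N, hN⟩ := c.support.exists_nat_subset_range
      refine ⟨N, fun n hn => ?_⟩
      set z := ∑ i ∈ c.support, c i • e i with hzdef
      have hQz : Q n z = z := by
        rw [hzdef, hQc, Finset.inter_eq_right.mpr (hN.trans (Finset.range_mono hn))]
      have h1 := hcontr n ((y : E) - z) (Submodule.sub_mem _ y.2
        (Submodule.le_topologicalClosure _ hz))
      rw [map_sub, hQz] at h1
      rw [dist_eq_norm] at hyz ⊢
      have h2 : Q n (y : E) - y = (Q n y - z) - ((y : E) - z) := by abel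
      rw [h2]
      have := norm_sub_le (Q n y - z) ((y : E) - z)
      linarith
    refine hmain.congr fun n => ?_
    rw [hQ]
    simp

/-! ### Existence of spreading models -/

lemma exists_banach_of_norm (ρ : (ℕ →₀ ℝ) → ℝ) (h0 : ∀ a, 0 ≤ ρ a)
    (hsmul : ∀ (c : ℝ) a, ρ (c • a) = |c| * ρ a) (hadd : ∀ a b, ρ (a + b) ≤ ρ a + ρ b)
    (hdef : ∀ a, ρ a = 0 → a = 0) :
    ∃ (E : Type) (_ : NormedAddCommGroup E) (_ : NormedSpace ℝ E) (_ : CompleteSpace E)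
      (e : ℕ → E), ∀ a : ℕ →₀ ℝ, ‖∑ i ∈ a.support, a i • e i‖ = ρ a := by
  let : Norm (ℕ →₀ ℝ) := ⟨ρ⟩
  have core : NormedSpace.Core ℝ (ℕ →₀ ℝ) :=
    { norm_nonneg := h0
      norm_smul := hsmul
      norm_triangle := hadd
      norm_eq_zero_iff := fun a => ⟨hdef a, by
        rintro rfl
        have := hsmul 0 0
        rw [zero_smul, abs_zero, zero_mul] at this
        exact this⟩ }
  let : NormedAddCommGroup (ℕ →₀ ℝ) := NormedAddCommGroup.ofCore core
  let : NormedSpace ℝ (ℕ →₀ ℝ) := NormedSpace.ofCore core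
  refine ⟨UniformSpace.Completion (ℕ →₀ ℝ), inferInstance, inferInstance, inferInstance,
    fun i => UniformSpace.Completion.toComplₗᵢ (𝕜 := ℝ) (Finsupp.single i 1), fun a => ?_⟩
  rw [← Finset.sum_congr rfl fun i _ => map_smul _ (a i) _, ← map_sum, LinearIsometry.norm_map]
  change ρ _ = ρ a
  congr 1
  conv_rhs => rw [← Finsupp.sum_single a]
  simp [Finsupp.sum]

/-- The iterated limits define a seminorm on finitely supported sequences. Suppression gives `|a i|
≤ ρ a`, so it is a norm, and suppression itself passes to the limit, so the unit vectors of the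
completion form a basic sequence. -/
lemma exists_isSpreadingModel {F : Type*} [NormedAddCommGroup F] [NormedSpace ℝ F] {x : ℕ → F}
    (hx : IsSuppressionUnconditional x) (hnorm : ∀ j, ‖x j‖ = 1)
    (hlim : ∀ (n : ℕ) (a : Fin n → ℝ), ∃ l, IteratedLim n (fun t => ‖∑ i, a i • x (t i)‖) l) :
    ∃ (E : Type) (_ : NormedAddCommGroup E) (_ : NormedSpace ℝ E) (_ : CompleteSpace E)
      (e : ℕ → E), IsSpreadingModel e x := by
  have hext : ∀ (a : ℕ → ℝ) (n : ℕ) (l : ℝ),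
      IteratedLim n (fun t => ‖∑ i : Fin n, a i • x (t i)‖) l →
      ∀ m, n ≤ m → (∀ i, n ≤ i → a i = 0) →
      IteratedLim m (fun t => ‖∑ i : Fin m, a i • x (t i)‖) l := by
    intro a n l h m hnm ha
    induction m, hnm using Nat.le_induction with
    | base => exact h
    | succ m hm ih =>
      convert ih.init using 3 with t
      rw [Fin.sum_univ_castSucc]
      simp [ha m hm, Fin.init]
  have hρ : ∀ a : ℕ →₀ ℝ, ∃ l, ∃ n₀, (∀ i, n₀ ≤ i → a i = 0) ∧ ∀ m, n₀ ≤ m →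
      IteratedLim m (fun t => ‖∑ i : Fin m, a i • x (t i)‖) l := fun a => by
    obtain ⟨N, hN⟩ := a.support.exists_nat_subset_range
    have ha : ∀ i, N ≤ i → a i = 0 := fun i hi => by
      by_contra h
      have := hN (Finsupp.mem_support_iff.mpr h)
      rw [Finset.mem_range] at this
      omega
    obtain ⟨l, hl⟩ := hlim N (fun i => a i)
    exact ⟨l, N, ha, fun m hm => hext a N l hl m hm ha⟩
  choose ρ n₀ hn₀ hρ using hρ
  have hsupp : ∀ (m : ℕ) (t : Fin m → ℕ), StrictMono t → ∀ (P : Fin m → Prop) [DecidablePred P]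
      (a : Fin m → ℝ), ‖∑ i, (if P i then a i else 0) • x (t i)‖ ≤ ‖∑ i, a i • x (t i)‖ := by
    intro m t ht P _ a
    classical
    -- The coefficients are moved from the positions `i` to the actual indices `t i`, where
    -- unconditionality of `x` is stated.
    let a' : ℕ → ℝ := fun j => if h : ∃ i, t i = j then a h.choose else 0
    have ha' : ∀ i, a' (t i) = a i := fun i => by
      have h : ∃ i', t i' = t i := ⟨i, rfl⟩
      simp only [a', dif_pos h]
      exact congrArg a (ht.injective h.choose_spec)
    have key := hx.2 ((Finset.univ.filter P).map ⟨t, ht.injective⟩)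
      (Finset.univ.map ⟨t, ht.injective⟩) a' (Finset.map_subset_map.mpr (Finset.filter_subset _ _))
    simp only [Finset.sum_map, Function.Embedding.coeFn_mk, ha'] at key
    simpa [ite_smul, Finset.sum_filter] using key
  have hcoord : ∀ a i, |a i| ≤ ρ a := fun a i => by
    let m := max (n₀ a) (i + 1)
    refine (IteratedLim.const m |a i|).mono (hρ a m (le_max_left _ _)) 0 fun t ht _ => ?_
    have hi : i < m := lt_of_lt_of_le (Nat.lt_succ_self i) (le_max_right _ _)
    have := hsupp m t ht (fun j => j = ⟨i, hi⟩) (fun j => a j)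
    simpa [norm_smul, hnorm] using this
  obtain ⟨E, _, _, _, e, he⟩ := exists_banach_of_norm ρ
    (fun a => (abs_nonneg _).trans (hcoord a 0))
    (fun c a => by
      let m := max (n₀ (c • a)) (n₀ a)
      refine (hρ (c • a) m (le_max_left _ _)).unique ?_
      convert (hρ a m (le_max_right _ _)).const_mul |c| using 2 with t
      rw [← Real.norm_eq_abs, ← norm_smul, Finset.smul_sum]
      simp [mul_smul])
    (fun a b => by
      let m := max (n₀ (a + b)) (max (n₀ a) (n₀ b))
      refine (hρ (a + b) m (le_max_left _ _)).mono
        ((hρ a m ((le_max_left _ _).trans (le_max_right _ _))).add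
          (hρ b m ((le_max_right _ _).trans (le_max_right _ _)))) 0 fun t _ _ => ?_
      refine le_trans (le_of_eq ?_) (norm_add_le _ _)
      rw [← Finset.sum_add_distrib]
      simp [add_smul])
    (fun a ha => Finsupp.ext fun i => abs_nonpos_iff.mp ((hcoord a i).trans ha.le))
  have hsum : ∀ (B : Finset ℕ) (a : ℕ → ℝ), ∃ c : ℕ →₀ ℝ, (∀ i, c i = if i ∈ B then a i else 0) ∧
      ‖∑ i ∈ B, a i • e i‖ = ρ c := fun B a => by
    classical
    let c : ℕ →₀ ℝ := Finsupp.onFinset B (fun i => if i ∈ B then a i else 0) (by simp +contextual)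
    refine ⟨c, fun i => rfl, ?_⟩
    rw [← he c]
    congr 1
    rw [Finset.sum_subset (Finsupp.support_onFinset_subset : c.support ⊆ B)
      (fun i _ hi => by rw [Finsupp.notMem_support_iff.mp hi, zero_smul])]
    exact Finset.sum_congr rfl fun i hi => by simp [c, hi]
  have hunc : IsSuppressionUnconditional e := by
    refine ⟨fun i hi => ?_, fun A B a hAB => ?_⟩
    · have h1 := hcoord (Finsupp.single i 1) i
      rw [← he, Finsupp.support_single _ one_ne_zero, Finset.sum_singleton, hi] at h1
      simp at h1
      linarith
    · obtain ⟨c, hc, hcA⟩ := hsum A a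
      obtain ⟨c', hc', hcB⟩ := hsum B a
      rw [hcA, hcB]
      let m := max (n₀ c) (n₀ c')
      refine (hρ c m (le_max_left _ _)).mono (hρ c' m (le_max_right _ _)) 0 fun t ht _ => ?_
      refine le_trans (le_of_eq ?_) (hsupp m t ht (fun i => (i : ℕ) ∈ A) fun i => c' i)
      congr 1
      refine Finset.sum_congr rfl fun i _ => ?_
      rw [hc, hc']
      split_ifs with h1 h2
      · rfl
      · exact absurd (hAB h1) h2
      · rfl
  refine ⟨E, inferInstance, inferInstance, inferInstance, e, hunc.isBasicSequence,
    hx.isBasicSequence, fun n a => ?_⟩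
  obtain ⟨c, hc, hcn⟩ := hsum (Finset.range n) fun i => if h : i < n then a ⟨i, h⟩ else 0
  have h1 : ‖∑ i : Fin n, a i • e i‖ = ρ c := by
    rw [← hcn, ← Fin.sum_univ_eq_sum_range
      (fun i => (if h : i < n then a ⟨i, h⟩ else 0) • e i) n]
    simp
  have hca : ∀ i : Fin n, c i = a i := fun i => by simp [hc]
  rw [h1]
  obtain ⟨l, hl⟩ := hlim n a
  have hl' := hext c n l (by simpa only [hca] using hl) (max n (n₀ c)) (le_max_left _ _)
    fun i hi => by rw [hc]; simp [hi]
  rwa [(hρ c _ (le_max_right _ _)).unique hl']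

namespace SpaceData

/-! ### Sequences of functionals -/

lemma Successive.comp {ι κ : Type} [LinearOrder ι] [LinearOrder κ] {f : ι → ℕ+ →₀ ℝ}
    (hf : Successive f) {e : κ → ι} (he : StrictMono e) : Successive fun q => f (e q) :=
  ⟨fun _ => hf.1 _, fun _ _ h => hf.2 _ _ (he h)⟩

lemma VeryFastGrowing.comp {ι κ : Type} [LinearOrder ι] [LinearOrder κ] {f : ι → ℕ+ →₀ ℝ}
    {s : ι → ℕ} (hf : VeryFastGrowing f s) {e : κ → ι} (he : StrictMono e) :
    VeryFastGrowing (fun q => f (e q)) fun q => s (e q) :=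
  ⟨fun _ => hf.1 _, fun _ _ h => hf.2 _ _ (he h)⟩

lemma VeryFastGrowing.successive {ι : Type} [LinearOrder ι] {f : ι → ℕ+ →₀ ℝ} {s : ι → ℕ}
    (hf : VeryFastGrowing f s) : Successive f :=
  ⟨hf.1, fun q q' h i hi j hj => by
    refine lt_of_le_of_lt ?_ ((hf.2 q q' h i hi).1 j hj)
    rw [pow_two]
    exact le_mul_of_one_le_left' (one_le (a := i))⟩

/-- Passing to smaller supports and larger sizes. -/
lemma VeryFastGrowing.shrink {ι : Type} [LinearOrder ι] {f g : ι → ℕ+ →₀ ℝ} {s s' : ι → ℕ}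
    (hf : VeryFastGrowing f s) (hg : ∀ q, g q ≠ 0) (hgf : ∀ q, (g q).support ⊆ (f q).support)
    (hs : ∀ q, s q ≤ s' q) : VeryFastGrowing g s' :=
  ⟨hg, fun q q' h i hi => ⟨fun j hj => (hf.2 q q' h i (hgf q hi)).1 j (hgf q' hj),
    (hf.2 q q' h i (hgf q hi)).2.trans_le (hs q')⟩⟩

lemma Successive.shrink {ι : Type} [LinearOrder ι] {f g : ι → ℕ+ →₀ ℝ}
    (hf : Successive f) (hg : ∀ q, g q ≠ 0) (hgf : ∀ q, (g q).support ⊆ (f q).support) :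
    Successive g :=
  ⟨hg, fun q q' h i hi j hj => hf.2 q q' h i (hgf q hi) j (hgf q' hj)⟩

lemma Successive.strictMono_mem {f : ℕ → ℕ+ →₀ ℝ} (hf : Successive f) {n : ℕ} {i : ℕ+}
    (hi : i ∈ (f n).support) : n < i := by
  induction n generalizing i with
  | zero => exact i.pos
  | succ n ih =>
    obtain ⟨j, hj⟩ := Finsupp.support_nonempty_iff.mpr (hf.1 n)
    have h1 := ih hj
    have h2 : (j : ℕ) < i := hf.2 n (n + 1) (Nat.lt_succ_self n) j hj i hi
    omega

/-! ### Norming functionals built over finite linear orders -/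

section Constructors

variable {P : SpaceData} {κ : Type} [LinearOrder κ] [Fintype κ] {f : κ → ℕ+ →₀ ℝ} {c : κ → ℝ}

lemma finLpNorm_orderIso (r : ℝ≥0∞) (e : Fin (Fintype.card κ) ≃o κ) (c : κ → ℝ) :
    finLpNorm r Finset.univ (fun i => c (e i)) = finLpNorm r Finset.univ c := by
  rw [← Finset.map_univ_equiv e.toEquiv, finLpNorm.map]
  rfl

variable [Nonempty κ]

/-- Arbitrary finite linear orders are allowed as index sets so that subfamilies of a given family
can be used without renumbering. -/
lemma isNorming_orderZero (hf : ∀ q, f q ∈ P.normingSet) (hs : Successive f)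
    (hc : finLpNorm (P.p P.ξ₀).conjExponent Finset.univ c ≤ 1) :
    P.IsNorming Label.orderZero (P.θ • ∑ q, c q • f q) := by
  let e := monoEquivOfFin κ rfl
  choose ℓ hℓ using hf
  rw [← Equiv.sum_comp e.toEquiv]
  refine IsNorming.orderZero Fintype.card_pos (fun i => f (e i)) (fun i => ℓ (e i))
    (fun i => c (e i)) (fun i => hℓ _) (hs.comp e.strictMono) ?_
  rwa [inUnitBall_iff (one_le_conjExponent _), finLpNorm_orderIso]

lemma isNorming_orderZeroSized (hf : ∀ q, f q ∈ P.normingSet) (hs : Successive f) {n : ℕ}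
    (hn : Fintype.card κ ≤ n) :
    P.IsNorming (Label.sized 0 n)
      (P.θ • ∑ q, ((1 / n : ℝ) ^ (1 / (P.p P.ξ₀).conjExponent.toReal)) • f q) := by
  let e := monoEquivOfFin κ rfl
  choose ℓ hℓ using hf
  rw [← Equiv.sum_comp e.toEquiv]
  exact IsNorming.orderZeroSized Fintype.card_pos (fun i => f (e i)) (fun i => ℓ (e i)) n
    (fun i => hℓ _) (hs.comp e.strictMono) hn

lemma isNorming_orderPos {k : ℕ} (hk : 1 ≤ k) (hkξ : (k : ℕ∞) < P.ξ₀) {o s : κ → ℕ}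
    (hf : ∀ q, P.IsNorming (Label.sized (o q) (s q)) (f q)) (ho : ∀ q, o q < k)
    (hfast : VeryFastGrowing f s)
    (hadm : ∀ q, ∀ i ∈ (f q).support, Fintype.card κ ≤ (i : ℕ))
    (hc : finLpNorm (P.p k).conjExponent Finset.univ c ≤ 1) :
    ∃ q₀, P.IsNorming (Label.sized k (s q₀)) (P.θ • ∑ q, c q • f q) := by
  let e := monoEquivOfFin κ rfl
  obtain ⟨q₀, -, hmin⟩ := Finset.exists_min_image Finset.univ s Finset.univ_nonempty
  refine ⟨q₀, ?_⟩
  rw [← Equiv.sum_comp e.toEquiv]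
  refine IsNorming.orderPos k hk hkξ (fun i => f (e i)) (fun i => o (e i)) (fun i => s (e i))
    (fun i => c (e i)) _ (fun i => hf _) (fun i => ho _)
    ⟨hfast.successive.comp e.strictMono, fun i => hadm _⟩ (hfast.comp e.strictMono) ?_ ?_
  · rwa [inUnitBall_iff (one_le_conjExponent _), finLpNorm_orderIso]
  · refine ⟨⟨e.symm q₀, by simp⟩, ?_⟩
    rintro _ ⟨i, rfl⟩
    exact hmin _ (Finset.mem_univ _)

end Constructors

lemma finLpNorm_coe_sort {ι : Type*} (r : ℝ≥0∞) (S : Finset ι) (c : ι → ℝ) :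
    finLpNorm r Finset.univ (fun q : S => c q) = finLpNorm r S c := by
  conv_rhs => rw [← Finset.attach_map_val (s := S), finLpNorm.map]
  rfl

/-! ### Restrictions of norming functionals -/

/-- Components whose restriction vanishes must be dropped, because successive families consist of
nonzero functionals. The set `S` depends neither on `θ` nor on the coefficients. -/
lemma exists_filter_smul_sum {d : ℕ} (A : ℕ+ → Prop) [DecidablePred A] (f : Fin d → ℕ+ →₀ ℝ) :
    ∃ S : Finset (Fin d), (∀ q ∈ S, (f q).filter A ≠ 0) ∧ ∀ (θ : ℝ) (c : Fin d → ℝ),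
      (θ • ∑ q, c q • f q).filter A = θ • ∑ q : S, c q • (f q).filter A := by
  classical
  refine ⟨Finset.univ.filter fun q => (f q).filter A ≠ 0, fun q hq => (Finset.mem_filter.mp hq).2,
    fun θ c => ?_⟩
  rw [Finset.sum_coe_sort _ fun q => c q • (f q).filter A, Finset.sum_filter_of_ne,
    Finsupp.filter_smul]
  · congr 1
    have := map_sum (Finsupp.filterAddHom A) (fun q => c q • f q) Finset.univ
    refine this.trans (Finset.sum_congr rfl fun q _ => ?_)
    exact Finsupp.filter_smul
  · intro q _ h h0
    exact h (by rw [h0, smul_zero])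

lemma support_filter_subset (A : ℕ+ → Prop) [DecidablePred A] (f : ℕ+ →₀ ℝ) :
    (f.filter A).support ⊆ f.support := by
  rw [Finsupp.support_filter]
  exact Finset.filter_subset _ _

/-- Every constructor survives the loss of some components. For a sized order-zero functional, `n`
only bounds the number of terms, so the size stays `n`. In positive order the size is a minimum over
components, which can only grow when components are removed and the others grow in size; larger
sizes and smaller supports keep the family very fast growing. -/
theorem IsNorming.filter {P : SpaceData} {ℓ : Label} {f : ℕ+ →₀ ℝ} (hf : P.IsNorming ℓ f)
    (A : ℕ+ → Prop) [DecidablePred A] (h0 : f.filter A ≠ 0) :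
    ∃ ℓ', P.IsNorming ℓ' (f.filter A) ∧
      ∀ k s, ℓ = Label.sized k s → ∃ s', s ≤ s' ∧ ℓ' = Label.sized k s' := by
  have hne : ∀ {d : ℕ} (S : Finset (Fin d)) (θ : ℝ) (g : S → ℕ+ →₀ ℝ),
      θ • ∑ q, g q ≠ 0 → Nonempty S := by
    intro d S θ g h
    by_contra hem
    rw [not_nonempty_iff] at hem
    exact h (by rw [Finset.univ_eq_empty, Finset.sum_empty, smul_zero])
  have hcard : ∀ {d : ℕ} (S : Finset (Fin d)), Fintype.card S ≤ d := fun S => by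
    rw [Fintype.card_coe]
    exact (Finset.card_le_univ S).trans_eq (Fintype.card_fin _)
  have hball : ∀ {d : ℕ} {r : ℝ≥0∞} (S : Finset (Fin d)) (c : Fin d → ℝ),
      InUnitBall r.conjExponent c →
      finLpNorm r.conjExponent Finset.univ (fun q : S => c q) ≤ 1 := fun S c hc => by
    rw [finLpNorm_coe_sort]
    rw [inUnitBall_iff (one_le_conjExponent _)] at hc
    exact (finLpNorm.mono (one_le_conjExponent _) (Finset.subset_univ _)
      fun _ _ => le_rfl).trans hc
  induction hf with
  | basis j ε hε =>
    have hj : A j := by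
      by_contra hj
      exact h0 (Finsupp.filter_single_of_neg _ hj)
    rw [Finsupp.filter_single_of_pos _ hj]
    exact ⟨_, IsNorming.basis j ε hε, fun _ _ h => Label.noConfusion h⟩
  | orderZero hd f ℓ c hf hsucc hc ih =>
    obtain ⟨S, hS, hfil⟩ := exists_filter_smul_sum A f
    rw [hfil] at h0 ⊢
    have := hne S _ _ h0
    refine ⟨_, isNorming_orderZero (fun q => ?_) ?_ (hball S c hc),
      fun _ _ h => Label.noConfusion h⟩
    · obtain ⟨ℓ', h, -⟩ := ih q (hS q q.2)
      exact ⟨ℓ', h⟩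
    · exact (hsucc.comp (Subtype.strictMono_coe _)).shrink (fun q => hS q q.2)
        fun q => support_filter_subset A _
  | orderZeroSized hd f ℓ n hf hsucc hdn ih =>
    obtain ⟨S, hS, hfil⟩ := exists_filter_smul_sum A f
    rw [hfil] at h0 ⊢
    have := hne S _ _ h0
    refine ⟨_, isNorming_orderZeroSized (fun q => ?_) ?_ ((hcard S).trans hdn),
      fun k s h => ⟨s, le_rfl, h⟩⟩
    · obtain ⟨ℓ', h, -⟩ := ih q (hS q q.2)
      exact ⟨ℓ', h⟩
    · exact (hsucc.comp (Subtype.strictMono_coe _)).shrink (fun q => hS q q.2)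
        fun q => support_filter_subset A _
  | orderPos k hk hkξ f o s c n hf ho hadm hfast hc hn ih =>
    obtain ⟨S, hS, hfil⟩ := exists_filter_smul_sum A f
    rw [hfil] at h0 ⊢
    have := hne S _ _ h0
    have ih' : ∀ q : S, ∃ s', s q ≤ s' ∧
        P.IsNorming (Label.sized (o q) s') ((f q).filter A) := fun q => by
      obtain ⟨ℓ', h, h'⟩ := ih q (hS q q.2)
      obtain ⟨s', hs', rfl⟩ := h' _ _ rfl
      exact ⟨s', hs', h⟩
    choose s' hs' hf' using ih'
    obtain ⟨q₀, h⟩ := isNorming_orderPos hk hkξ hf' (fun q => ho q)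
      ((hfast.comp (Subtype.strictMono_coe _)).shrink (fun q => hS q q.2)
        (fun q => support_filter_subset A _) hs')
      (fun q i hi => (hcard S).trans (hadm.2 q i (support_filter_subset A _ hi))) (hball S c hc)
    refine ⟨_, h, fun k' n' h => ?_⟩
    injection h with h1 h2
    subst h1 h2
    exact ⟨s' q₀, (hn.2 ⟨q₀, rfl⟩).trans (hs' q₀), rfl⟩

/-! ### The action -/

lemma act_eq_sum (f x : ℕ+ →₀ ℝ) : act f x = ∑ i ∈ x.support, f i * x i := rfl

lemma exists_mem_of_act_ne_zero {f x : ℕ+ →₀ ℝ} (h : act f x ≠ 0) :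
    ∃ i, i ∈ f.support ∧ i ∈ x.support := by
  obtain ⟨i, hi, h'⟩ := Finset.exists_ne_zero_of_sum_ne_zero h
  exact ⟨i, Finsupp.mem_support_iff.mpr (left_ne_zero_of_mul h'), hi⟩

lemma act_filter_of_subset {f x : ℕ+ →₀ ℝ} (A : ℕ+ → Prop) [DecidablePred A]
    (h : ∀ i ∈ x.support, A i) : act (f.filter A) x = act f x :=
  Finset.sum_congr rfl fun i hi => by simp only [Finsupp.filter_apply_pos A f (h i hi)]

lemma act_filter_of_disjoint {f x : ℕ+ →₀ ℝ} (A : ℕ+ → Prop) [DecidablePred A]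
    (h : ∀ i ∈ x.support, ¬ A i) : act (f.filter A) x = 0 :=
  Finset.sum_eq_zero fun i hi => by simp only [Finsupp.filter_apply_neg A f (h i hi), zero_mul]

lemma act_combination {ι : Type*} (θ : ℝ) (S : Finset ι) (c : ι → ℝ) (f : ι → ℕ+ →₀ ℝ)
    (x : ℕ+ →₀ ℝ) : act (θ • ∑ q ∈ S, c q • f q) x = θ * ∑ q ∈ S, c q * act (f q) x := by
  simp only [act_eq_sum, Finsupp.smul_apply, Finsupp.finsetSum_apply, smul_eq_mul,
    Finset.mul_sum, Finset.sum_mul]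
  rw [Finset.sum_comm]
  exact Finset.sum_congr rfl fun _ _ => Finset.sum_congr rfl fun _ _ => by ring

lemma act_sum (P : SpaceData) {ι : Type*} (f : ℕ+ →₀ ℝ) (I : Finset ι) (a : ι → ℝ)
    (v : ι → P.C00) : act f (∑ i ∈ I, a i • v i : P.C00) = ∑ i ∈ I, a i * act f (v i) := by
  classical
  induction I using Finset.induction_on with
  | empty => exact Finsupp.sum_zero_index
  | insert i I hi ih =>
    rw [Finset.sum_insert hi, Finset.sum_insert hi, ← ih]
    exact (act_add f _ _).trans (congrArg (· + _) (act_smul f (a i) (v i)))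

lemma zero_act (x : ℕ+ →₀ ℝ) : act 0 x = 0 := by simp [act_eq_sum]

lemma exists_norming (P : SpaceData) {x : P.C00} (hx : ‖x‖ = 1) :
    ∃ f ∈ P.normingSet, 1 / 2 ≤ |act f x| := by
  obtain ⟨⟨f, hf⟩, h⟩ := exists_lt_of_lt_ciSup
    (show 1 / 2 < ⨆ f : P.normingSet, |act f.1 x| by rw [← norm_def, hx]; norm_num)
  exact ⟨f, hf, h.le⟩

lemma norm_le_of_forall_act (P : SpaceData) {x : P.C00} {M : ℝ}
    (h : ∀ f ∈ P.normingSet, |act f x| ≤ M) : ‖x‖ ≤ M := by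
  rw [norm_def]
  exact ciSup_le fun f => h f.1 f.2

/-! ### Normalized block sequences -/

namespace IsNormalizedBlock

variable {P : SpaceData} {u : ℕ → P.C00} {x : ℕ → P.X}

lemma comp (hx : P.IsNormalizedBlock u x) {φ : ℕ → ℕ} (hφ : StrictMono φ) :
    P.IsNormalizedBlock (u ∘ φ) (x ∘ φ) :=
  ⟨fun _ => hx.1 _, hx.2.1.comp hφ, fun _ => hx.2.2 _⟩

lemma norm_eq_one (hx : P.IsNormalizedBlock u x) (j : ℕ) : ‖u j‖ = 1 := by
  rw [← UniformSpace.Completion.norm_coe, ← hx.1, hx.2.2]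

lemma norm_sum (hx : P.IsNormalizedBlock u x) {ι : Type*} (I : Finset ι) (a : ι → ℝ)
    (t : ι → ℕ) : ‖∑ i ∈ I, a i • x (t i)‖ = ‖∑ i ∈ I, a i • u (t i)‖ := by
  rw [← LinearIsometry.norm_map (UniformSpace.Completion.toComplₗᵢ (𝕜 := ℝ) (E := P.C00)),
    map_sum]
  simp [hx.1]

lemma abs_act_le_one (hx : P.IsNormalizedBlock u x) {f : ℕ+ →₀ ℝ} (hf : f ∈ P.normingSet)
    (j : ℕ) : |act f (u j)| ≤ 1 :=
  (P.abs_act_le_norm hf _).trans_eq (hx.norm_eq_one j)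

lemma eq_of_mem_support (hx : P.IsNormalizedBlock u x) {j j' : ℕ} {i : ℕ+}
    (h : i ∈ Finsupp.support (u j)) (h' : i ∈ Finsupp.support (u j')) : j = j' := by
  rcases lt_trichotomy j j' with hl | hl | hl
  · exact absurd (hx.2.1.2 j j' hl i h i h') (lt_irrefl i)
  · exact hl
  · exact absurd (hx.2.1.2 j' j hl i h' i h) (lt_irrefl i)

lemma isSuppressionUnconditional (hx : P.IsNormalizedBlock u x) :
    IsSuppressionUnconditional x := by
  classical
  refine ⟨fun i hi => ?_, fun A B a hAB => ?_⟩
  · have := hx.2.2 i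
    rw [hi, norm_zero] at this
    exact zero_ne_one this
  · refine (hx.norm_sum A a id).trans_le (le_trans ?_ (hx.norm_sum B a id).ge)
    refine P.norm_le_of_forall_act fun f ⟨ℓ, hf⟩ => ?_
    -- Restricting `f` to the supports of the vectors indexed by `A` kills the terms in `B \ A` and
    -- does not affect the others.
    let D : ℕ+ → Prop := fun i => ∃ j ∈ A, i ∈ Finsupp.support (u j)
    have hD : act f (∑ i ∈ A, a i • u (id i) : P.C00)
        = act (f.filter D) (∑ i ∈ B, a i • u (id i) : P.C00) := by
      rw [act_sum, act_sum, ← Finset.sum_subset hAB]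
      · refine Finset.sum_congr rfl fun j hj => ?_
        exact congrArg (a j * ·)
          (act_filter_of_subset (x := u j) D fun i hi => ⟨j, hj, hi⟩).symm
      · intro j _ hj
        refine (congrArg (a j * ·) (act_filter_of_disjoint (x := u j) D ?_)).trans (mul_zero _)
        rintro i hi ⟨j', hj', hi'⟩
        exact hj (hx.eq_of_mem_support hi hi' ▸ hj')
    rw [hD]
    by_cases h0 : f.filter D = 0
    · rw [h0]
      exact (abs_eq_zero.mpr (zero_act _)).trans_le (norm_nonneg _)
    · obtain ⟨ℓ', h, -⟩ := hf.filter D h0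
      exact P.abs_act_le_norm ⟨ℓ', h⟩ _

end IsNormalizedBlock

end SpaceData

namespace SpaceData

/-! ### Exponents -/

lemma one_le_exponent (P : SpaceData) {ζ : ℕ∞} (h1 : 1 ≤ ζ) (h : ζ ≤ P.ξ₀) : 1 ≤ P.p ζ :=
  P.one_le_p.trans (P.p_strictMonoOn.monotoneOn ⟨le_rfl, h1.trans h⟩ ⟨h1, h⟩ h1)

lemma exponent_mono (P : SpaceData) {ζ η : ℕ∞} (h1 : 1 ≤ ζ) (hζη : ζ ≤ η) (h : η ≤ P.ξ₀) :
    P.p ζ ≤ P.p η :=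
  P.p_strictMonoOn.monotoneOn ⟨h1, hζη.trans h⟩ ⟨h1.trans hζη, h⟩ hζη

lemma exponent_lt (P : SpaceData) {ζ η : ℕ∞} (h1 : 1 ≤ ζ) (hζη : ζ < η) (h : η ≤ P.ξ₀) :
    P.p ζ < P.p η :=
  P.p_strictMonoOn ⟨h1, hζη.le.trans h⟩ ⟨h1.trans hζη.le, h⟩ hζη

lemma one_le_ξ₀ (P : SpaceData) : 1 ≤ P.ξ₀ := le_trans (by norm_num) P.two_le_ξ₀

lemma one_lt_exponent_ξ₀ (P : SpaceData) : 1 < P.p P.ξ₀ :=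
  P.one_le_p.trans_lt (P.exponent_lt le_rfl (lt_of_lt_of_le (by norm_num) P.two_le_ξ₀) le_rfl)

/-! ### Lower estimates -/

section Lower

variable {P : SpaceData} {u : ℕ → P.C00} {x : ℕ → P.X}

/-- As `g i` lives on the support of `u (t i)`, it sees only the `i`-th term of the sum. Choosing
`c` dual to the numbers `a i * g_i(u (t i))` makes the combination attain their `ℓ_r` norm up to the
factor `θ`. Nonemptiness appears in `hW` because empty combinations are not in `W`. -/
lemma lower_estimate_of_combinations (hx : P.IsNormalizedBlock u x) {r : ℝ≥0∞} (hr : 1 ≤ r)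
    {δ : ℝ} (hδ : 0 ≤ δ) {n : ℕ} {t : Fin n → ℕ} (ht : StrictMono t) (g : Fin n → ℕ+ →₀ ℝ)
    (hg : ∀ i, (g i).support ⊆ Finsupp.support (u (t i)))
    (hgu : ∀ i, δ ≤ |act (g i) (u (t i))|)
    (hW : ∀ [Nonempty (Fin n)] (c : Fin n → ℝ), finLpNorm r.conjExponent Finset.univ c ≤ 1 →
      P.θ • ∑ i, c i • g i ∈ P.normingSet) (a : Fin n → ℝ) :
    P.θ * δ * finLpNorm r Finset.univ a ≤ ‖∑ i, a i • u (t i)‖ := by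
  rcases isEmpty_or_nonempty (Fin n) with hn | hn
  · rw [Finset.univ_eq_empty, finLpNorm.empty hr, mul_zero]
    exact norm_nonneg _
  have hb : δ * finLpNorm r Finset.univ a
      ≤ finLpNorm r Finset.univ (fun i => a i * act (g i) (u (t i))) := by
    rw [← abs_of_nonneg hδ, ← finLpNorm.mul_left hr]
    refine finLpNorm.mono hr le_rfl fun i _ => ?_
    rw [abs_mul, abs_mul, abs_of_nonneg hδ, mul_comm]
    exact mul_le_mul_of_nonneg_left (hgu i) (abs_nonneg _)
  obtain ⟨c, hc, hcb⟩ := finLpNorm.exists_dual hr Finset.univ fun i => a i * act (g i) (u (t i))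
  have hact : ∀ i, act (g i) (∑ j, a j • u (t j) : P.C00) = a i * act (g i) (u (t i)) := by
    intro i
    rw [act_sum]
    refine Finset.sum_eq_single i (fun j _ hj => ?_) (fun h => absurd (Finset.mem_univ i) h)
    by_contra h
    obtain ⟨m, hm, hm'⟩ := exists_mem_of_act_ne_zero (right_ne_zero_of_mul h)
    exact hj (ht.injective (hx.eq_of_mem_support hm' (hg i hm)))
  have h1 := P.abs_act_le_norm (hW c hc) (∑ j, a j • u (t j) : P.C00)
  have h2 : act (P.θ • ∑ i, c i • g i) (∑ j, a j • u (t j) : P.C00)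
      = P.θ * finLpNorm r Finset.univ (fun i => a i * act (g i) (u (t i))) := by
    refine (act_combination _ _ _ _ _).trans ?_
    rw [← hcb]
    exact congrArg (P.θ * ·) (Finset.sum_congr rfl fun i _ => congrArg (c i * ·) (hact i))
  calc P.θ * δ * finLpNorm r Finset.univ a
      = P.θ * (δ * finLpNorm r Finset.univ a) := mul_assoc _ _ _
    _ ≤ P.θ * finLpNorm r Finset.univ (fun i => a i * act (g i) (u (t i))) :=
        mul_le_mul_of_nonneg_left hb P.θ_pos.le
    _ ≤ _ := h2.ge.trans (le_abs_self _)
    _ ≤ _ := h1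

/-- A functional that acts on a vector can be restricted to the support of the vector. -/
lemma exists_restriction {ℓ : Label} {f : ℕ+ →₀ ℝ} (hf : P.IsNorming ℓ f) {w : ℕ+ →₀ ℝ}
    (h : act f w ≠ 0) :
    ∃ g ℓ', P.IsNorming ℓ' g ∧ (∀ k s, ℓ = Label.sized k s → ∃ s', s ≤ s' ∧ ℓ' = Label.sized k s') ∧
      g ≠ 0 ∧ g.support ⊆ f.support ∧ g.support ⊆ w.support ∧ act g w = act f w := by
  classical
  have hact : act (f.filter (· ∈ w.support)) w = act f w :=
    act_filter_of_subset _ fun i hi => hi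
  have h0 : f.filter (· ∈ w.support) ≠ 0 := fun h0 => h (by rw [← hact, h0, zero_act])
  obtain ⟨ℓ', h1, h2⟩ := hf.filter _ h0
  refine ⟨_, ℓ', h1, h2, h0, support_filter_subset _ _, fun i hi => ?_, hact⟩
  rw [Finsupp.support_filter, Finset.mem_filter] at hi
  exact hi.2

lemma IsNormalizedBlock.lower_estimate (hx : P.IsNormalizedBlock u x) {n : ℕ} {t : Fin n → ℕ}
    (ht : StrictMono t) (a : Fin n → ℝ) :
    P.θ * (1 / 2) * finLpNorm (P.p P.ξ₀) Finset.univ a ≤ ‖∑ i, a i • u (t i)‖ := by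
  have h : ∀ i, ∃ g ∈ P.normingSet, g ≠ 0 ∧ g.support ⊆ Finsupp.support (u (t i)) ∧
      1 / 2 ≤ |act g (u (t i))| := fun i => by
    obtain ⟨f, ⟨ℓ, hf⟩, hfx⟩ := P.exists_norming (hx.norm_eq_one (t i))
    have hne : act f (u (t i)) ≠ 0 := fun h0 => by
      have h2 : |act f (u (t i))| = 0 := abs_eq_zero.mpr h0
      linarith
    obtain ⟨g, ℓ', h1, -, h0, -, h3, h4⟩ := exists_restriction hf hne
    exact ⟨g, ⟨ℓ', h1⟩, h0, h3, hfx.trans_eq (congrArg abs h4.symm)⟩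
  choose g hgW hg0 hgs hg using h
  have hr := P.one_le_exponent P.one_le_ξ₀ le_rfl
  refine lower_estimate_of_combinations hx hr (by norm_num) ht g hgs hg (fun c hc => ?_) a
  exact ⟨_, isNorming_orderZero hgW ((hx.2.1.comp ht).shrink hg0 hgs) hc⟩

/-- A failure of the limit gives a subsequence with action at least `ε`. The witnesses, restricted
to the vectors, remain very fast growing, and `n ≤ t i` yields admissibility since the `j`-th vector
is supported beyond `j`. -/
lemma IsNormalizedBlock.exists_lower_estimate_of_alphaIndexPos (hx : P.IsNormalizedBlock u x)
    {k : ℕ} (hk : 1 ≤ k) (hkξ : (k : ℕ∞) < P.ξ₀) (hα : P.AlphaIndexPos k u) :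
    ∃ φ : ℕ → ℕ, StrictMono φ ∧ ∃ δ : ℝ, 0 < δ ∧ ∀ (n : ℕ) (t : Fin n → ℕ), StrictMono t →
      (∀ i, n ≤ t i) → ∀ a : Fin n → ℝ,
        δ * finLpNorm (P.p k) Finset.univ a ≤ ‖∑ i, a i • u (φ (t i))‖ := by
  simp only [AlphaIndexPos, AlphaIndexZero, not_forall] at hα
  obtain ⟨f, o, s, hf, ho, hfast, φ, hφ, hlim⟩ := hα
  rw [Metric.tendsto_atTop] at hlim
  push Not at hlim
  obtain ⟨ε, hε, hlim⟩ := hlim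
  obtain ⟨ψ, hψ, hψε⟩ := extraction_of_frequently_atTop (frequently_atTop.mpr hlim)
  have hlow : ∀ i, ε ≤ |act (f (ψ i)) (u (φ (ψ i)))| := fun i => by
    have := hψε i
    rwa [Real.dist_eq, sub_zero, abs_abs] at this
  have h : ∀ i, ∃ g s', P.IsNorming (Label.sized (o (ψ i)) s') g ∧ s (ψ i) ≤ s' ∧ g ≠ 0 ∧
      g.support ⊆ (f (ψ i)).support ∧ g.support ⊆ Finsupp.support (u (φ (ψ i))) ∧
      ε ≤ |act g (u (φ (ψ i)))| := fun i => by
    have hne : act (f (ψ i)) (u (φ (ψ i))) ≠ 0 := fun h0 => by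
      have h2 : |act (f (ψ i)) (u (φ (ψ i)))| = 0 := abs_eq_zero.mpr h0
      linarith [hlow i]
    obtain ⟨g, ℓ', h1, h2, h3, h4, h5, h6⟩ := exists_restriction (hf (ψ i)) hne
    obtain ⟨s', hs', rfl⟩ := h2 _ _ rfl
    exact ⟨g, s', h1, hs', h3, h4, h5, (hlow i).trans_eq (congrArg abs h6.symm)⟩
  choose g s' hg hs' hg0 hgf hgu hgε using h
  refine ⟨φ ∘ ψ, hφ.comp hψ, P.θ * ε, mul_pos P.θ_pos hε, fun n t ht hnt a => ?_⟩
  have hr := P.one_le_exponent (ζ := k) (by exact_mod_cast hk) hkξ.le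
  refine lower_estimate_of_combinations hx hr hε.le ((hφ.comp hψ).comp ht) (fun i => g (t i))
    (fun i => hgu _) (fun i => hgε _) (fun c hc => ?_) a
  obtain ⟨q₀, h⟩ := isNorming_orderPos hk hkξ (fun q => hg (t q)) (fun q => ho _)
    ((hfast.comp (hψ.comp ht)).shrink (fun q => hg0 _) (fun q => hgf _) fun q => hs' _)
    (fun q i hi => by
      rw [Fintype.card_fin]
      exact (hnt q).trans (((hφ.comp hψ).id_le _).trans
        (hx.2.1.strictMono_mem (hgu _ hi)).le)) hc
  exact ⟨_, h⟩

end Lower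

end SpaceData

namespace SpaceData

/-! ### Sparse subsequences -/

lemma exists_nat_seq (G : ℕ → ℕ → ℕ) : ∃ φ : ℕ → ℕ, ∀ t, φ (t + 1) = G t (φ t) :=
  ⟨fun t => Nat.rec 0 G t, fun _ => rfl⟩

section Sparse

variable {P : SpaceData} {u : ℕ → P.C00} {x : ℕ → P.X}

lemma exists_support_bound (u : ℕ → P.C00) :
    ∃ B : ℕ → ℕ, ∀ j, ∀ i ∈ Finsupp.support (u j), (i : ℕ) ≤ B j :=
  ⟨fun j => (Finsupp.support (u j)).sup fun i => (i : ℕ),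
    fun _ _ hi => Finset.le_sup (f := fun i : ℕ+ => (i : ℕ)) hi⟩

lemma AlphaIndexZero.mono {k k' : ℕ} (h : P.AlphaIndexZero k u) (hk : k' ≤ k) :
    P.AlphaIndexZero k' u := fun f o s hf ho hfast φ hφ =>
  h f o s hf (fun q => (ho q).trans_le hk) hfast φ hφ

lemma AlphaIndexZero.comp {k : ℕ} (h : P.AlphaIndexZero k u) {φ : ℕ → ℕ} (hφ : StrictMono φ) :
    P.AlphaIndexZero k (u ∘ φ) := fun f o s hf ho hfast ψ hψ =>
  h f o s hf ho hfast (φ ∘ ψ) (hφ.comp hψ)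

/-- If it failed for some `ε`, a diagonal choice of bad pairs would produce a very fast growing
sequence acting by at least `ε` along a subsequence. -/
lemma AlphaIndexZero.uniform {k : ℕ} (h : P.AlphaIndexZero k u)
    (hx : P.IsNormalizedBlock u x) {ε : ℝ} (hε : 0 < ε) :
    ∃ N, ∀ j, N ≤ j → ∀ f o s, o < k → P.IsNorming (Label.sized o s) f → N ≤ s →
      |act f (u j)| ≤ ε := by
  by_contra hcon
  push Not at hcon
  have h' : ∀ N, ∃ j, N ≤ j ∧ ∃ g o s, o < k ∧ P.IsNorming (Label.sized o s) g ∧ N ≤ s ∧ g ≠ 0 ∧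
      g.support ⊆ Finsupp.support (u j) ∧ ε ≤ |act g (u j)| := fun N => by
    obtain ⟨j, hj, f, o, s, ho, hf, hs, hlt⟩ := hcon N
    have hne : act f (u j) ≠ 0 := fun h0 => by
      have h2 : |act f (u j)| = 0 := abs_eq_zero.mpr h0
      linarith
    obtain ⟨g, ℓ', h1, h2, h3, -, h5, h6⟩ := exists_restriction hf hne
    obtain ⟨s', hs', rfl⟩ := h2 _ _ rfl
    exact ⟨j, hj, g, o, s', ho, h1, hs.trans hs', h3, h5, hlt.le.trans_eq (congrArg abs h6.symm)⟩
  choose j hj g o s ho hg hs hg0 hgu hgε using h'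
  obtain ⟨B, hB⟩ := exists_support_bound u
  -- The next threshold exceeds the current index (so indices increase), the square of the current
  -- support bound (so supports are far apart), and the bound itself (so sizes are large enough).
  obtain ⟨M, hM⟩ := exists_nat_seq fun _ m => m + j m + B (j m) ^ 2 + B (j m) + 1
  have hMmono : StrictMono M := strictMono_nat_of_lt_succ fun t => by rw [hM]; omega
  have hstep : ∀ q q', q < q' → j (M q) + B (j (M q)) ^ 2 + B (j (M q)) < M q' :=
    fun q q' hqq => by
      have h1 : M (q + 1) ≤ M q' := hMmono.monotone hqq
      rw [hM] at h1
      omega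
  have hlim := h (fun q => g (M q)) (fun q => o (M q)) (fun q => s (M q)) (fun q => hg _)
    (fun q => ho _) ⟨fun q => hg0 _, fun q q' hqq i hi => ?_⟩ (fun q => j (M q))
    (strictMono_nat_of_lt_succ fun q => by
      have := hstep q (q + 1) (Nat.lt_succ_self q)
      have := hj (M (q + 1))
      omega)
  · exact absurd (ge_of_tendsto hlim (Eventually.of_forall fun q => hgε (M q))) (not_le.mpr hε)
  · have h1 := hstep q q' hqq
    have h2 := hB _ _ (hgu _ hi)
    have h3 := hs (M q')
    refine ⟨fun l hl => ?_, show (i : ℕ) < s (M q') by omega⟩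
    have h4 := hx.2.1.strictMono_mem (hgu _ hl)
    have h5 := hj (M q')
    have h6 : (i : ℕ) ^ 2 ≤ B (j (M q)) ^ 2 := Nat.pow_le_pow_left h2 2
    rw [← PNat.coe_lt_coe, PNat.pow_coe]
    omega

/-- Functionals of order `o` with `o + 1 < K` whose size exceeds some coordinate of the support of
a later vector are negligible on all later vectors. -/
def Sparse (P : SpaceData) (K : ℕ) (v : ℕ → ℕ+ →₀ ℝ) : Prop :=
  ∀ f o s, P.IsNorming (Label.sized o s) f → o + 1 < K → ∀ t i i', t < i → t < i' →
    ∀ j ∈ (v i).support, (j : ℕ) < s → ∀ m ∈ (v t).support,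
      |act f (v i')| * ((m : ℕ) * (t + 1)) ≤ 1

lemma IsNormalizedBlock.exists_sparse (hx : P.IsNormalizedBlock u x) {K : ℕ}
    (hα : ∀ k, 1 ≤ k → k < K → P.AlphaIndexZero k u) :
    ∃ φ : ℕ → ℕ, StrictMono φ ∧ P.Sparse K fun i => u (φ i) := by
  -- The threshold is made a total function of `ε` so that it can enter the recursion for `φ`. Its
  -- value for `ε ≤ 0` is irrelevant, and for `K < 2` no functional qualifies.
  have hN : ∀ ε : ℝ, ∃ N, 0 < ε → ∀ j, N ≤ j → ∀ f o s, o + 1 < K →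
      P.IsNorming (Label.sized o s) f → N ≤ s → |act f (u j)| ≤ ε := fun ε => by
    by_cases hK : K < 2
    · exact ⟨0, fun _ _ _ _ _ _ ho => by omega⟩
    by_cases hε : 0 < ε
    · obtain ⟨N, hN⟩ := (hα (K - 1) (by omega) (by omega)).uniform hx hε
      exact ⟨N, fun _ j hj f o s ho => hN j hj f o s (by omega)⟩
    · exact ⟨0, fun h => absurd h hε⟩
  choose N hN using hN
  obtain ⟨B, hB⟩ := exists_support_bound u
  -- Later indices lie beyond the threshold for `ε = 1 / ((B (φ t) + 1) * (t + 1))`. Since a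
  -- coordinate of the `i`-th vector exceeds `φ i`, a size above that coordinate is above the
  -- threshold too.
  obtain ⟨φ, hφ⟩ := exists_nat_seq fun t m => m + 1 + N (1 / ((B m + 1) * (t + 1)))
  have hmono : StrictMono φ := strictMono_nat_of_lt_succ fun t => by rw [hφ]; omega
  refine ⟨φ, hmono, fun f o s hf ho t i i' hti hti' j hj hjs m hm => ?_⟩
  have hpos : (0 : ℝ) < (B (φ t) + 1) * (t + 1) := by positivity
  have hge : ∀ i, t < i → N (1 / ((B (φ t) + 1) * (t + 1))) ≤ φ i := fun i hi => by
    have h1 : φ (t + 1) ≤ φ i := hmono.monotone hi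
    rw [hφ] at h1
    omega
  have h1 : (φ i : ℕ) < j := hx.2.1.strictMono_mem hj
  have h2 := hN _ (one_div_pos.mpr hpos) (φ i') (hge i' hti') f o s ho hf
    (by have := hge i hti; omega)
  have h3 : ((m : ℕ) : ℝ) ≤ B (φ t) := by exact_mod_cast hB _ _ hm
  calc |act f (u (φ i'))| * ((m : ℕ) * (t + 1))
      ≤ 1 / ((B (φ t) + 1) * (t + 1)) * ((B (φ t) + 1) * (t + 1)) := by
        gcongr
        linarith
    _ = 1 := one_div_mul_cancel hpos.ne'

end Sparse

/-! ### Upper estimates -/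

/-- For each component `f q`, the first vector it meets is separated from the later ones. The first
encounters are grouped by vector and bounded through membership in `W` and Hölder with exponent `r`.
The later ones form disjoint sets `J q`, to which the induction hypothesis and Hölder with exponent
`p` apply. -/
lemma split_estimate {v : ℕ → ℕ+ →₀ ℝ} (hv : Successive v) {p r : ℝ≥0∞} (hp : 1 ≤ p)
    (hpr : p ≤ r) {θ : ℝ} (hθ0 : 0 < θ) (hθ : θ ≤ 1 / 4) {d : ℕ} {f : Fin d → ℕ+ →₀ ℝ}
    (hf : Successive f) {c : Fin d → ℝ} (hc : finLpNorm r.conjExponent Finset.univ c ≤ 1)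
    (hW : ∀ (S : Finset (Fin d)) (c' : Fin d → ℝ), finLpNorm r.conjExponent S c' ≤ 1 →
      ∀ i, |θ * ∑ q ∈ S, c' q * act (f q) (v i)| ≤ 1)
    (I : Finset ℕ) (a : ℕ → ℝ)
    (ih : ∀ q, ∀ I' ⊆ I, |∑ i ∈ I', a i * act (f q) (v i)| ≤ 4 * finLpNorm p I' a) :
    |∑ i ∈ I, a i * (θ * ∑ q, c q * act (f q) (v i))| ≤ 4 * finLpNorm p I a := by
  classical
  have hr : 1 ≤ r := hp.trans hpr
  have hr' : 1 ≤ r.conjExponent := one_le_conjExponent r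
  let A : Fin d → Finset ℕ := fun q => I.filter fun i => act (f q) (v i) ≠ 0
  -- `Q i` collects the components whose first encounter is with `v i`; `J q` below collects the
  -- later encounters of `f q`.
  let Q : ℕ → Finset (Fin d) := fun i =>
    Finset.univ.filter fun q => i ∈ A q ∧ ∀ i' ∈ A q, i ≤ i'
  let J : Fin d → Finset ℕ := fun q => (A q).filter fun i => ∃ i' ∈ A q, i' < i
  have hQ : ∀ i q, q ∈ Q i ↔ i ∈ A q ∧ ∀ i' ∈ A q, i ≤ i' := fun i q => by simp [Q]
  have hJI : ∀ q, J q ⊆ I := fun q =>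
    (Finset.filter_subset _ _).trans (Finset.filter_subset _ _)
  have hQdisj : (I : Set ℕ).PairwiseDisjoint Q := by
    intro i _ i' _ hne
    rw [Function.onFun, Finset.disjoint_left]
    intro q hq hq'
    rw [hQ] at hq hq'
    exact hne (le_antisymm (hq.2 _ hq'.1) (hq'.2 _ hq.1))
  have hJlt : ∀ q q', q < q' → Disjoint (J q) (J q') := by
    intro q q' hqq
    rw [Finset.disjoint_left]
    intro i hi hi'
    obtain ⟨hiA, -⟩ := Finset.mem_filter.mp hi
    obtain ⟨-, i', hi'A, hlt⟩ := Finset.mem_filter.mp hi'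
    -- If `i` were in both sets with `q < q'`, then `f q'` would meet a vector before `v i` although
    -- it lies to the right of `f q`, which meets `v i`.
    obtain ⟨m, hm, hmv⟩ := exists_mem_of_act_ne_zero (Finset.mem_filter.mp hiA).2
    obtain ⟨m', hm', hmv'⟩ := exists_mem_of_act_ne_zero (Finset.mem_filter.mp hi'A).2
    exact lt_asymm (hf.2 q q' hqq m hm m' hm') (hv.2 i' i hlt m' hmv' m hmv)
  have hJdisj : ((Finset.univ : Finset (Fin d)) : Set (Fin d)).PairwiseDisjoint J := by
    intro q _ q' _ hne
    rcases lt_or_gt_of_ne hne with h | h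
    · exact hJlt q q' h
    · exact (hJlt q' q h).symm
  have hpt : ∀ q, ∑ i ∈ I, a i * act (f q) (v i) =
      ∑ i ∈ I, (if q ∈ Q i then a i * act (f q) (v i) else 0)
        + ∑ i ∈ J q, a i * act (f q) (v i) := by
    intro q
    have hJ : J q = I.filter fun i => i ∈ A q ∧ ∃ i' ∈ A q, i' < i := by
      ext i
      simp only [J, A, Finset.mem_filter]
      tauto
    rw [hJ, Finset.sum_filter, ← Finset.sum_add_distrib]
    refine Finset.sum_congr rfl fun i hi => ?_
    by_cases hiA : i ∈ A q
    · by_cases hmin : ∃ i' ∈ A q, i' < i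
      · have : q ∉ Q i := fun h => by
          obtain ⟨i', hi', hlt⟩ := hmin
          exact absurd (((hQ i q).mp h).2 i' hi') (not_le.mpr hlt)
        rw [if_neg this, if_pos ⟨hiA, hmin⟩, zero_add]
      · have : q ∈ Q i := (hQ i q).mpr ⟨hiA, fun i' hi' => not_lt.mp fun h => hmin ⟨i', hi', h⟩⟩
        rw [if_pos this, if_neg fun h => hmin h.2, add_zero]
    · have h0 : act (f q) (v i) = 0 := by
        by_contra h
        exact hiA (Finset.mem_filter.mpr ⟨hi, h⟩)
      simp [h0]
  have hsum : ∑ i ∈ I, a i * (θ * ∑ q, c q * act (f q) (v i)) =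
      ∑ i ∈ I, a i * (θ * ∑ q ∈ Q i, c q * act (f q) (v i))
        + θ * ∑ q, c q * ∑ i ∈ J q, a i * act (f q) (v i) := by
    have e1 : ∑ i ∈ I, a i * (θ * ∑ q, c q * act (f q) (v i))
        = θ * ∑ q, c q * ∑ i ∈ I, a i * act (f q) (v i) := by
      simp only [Finset.mul_sum]
      rw [Finset.sum_comm]
      exact Finset.sum_congr rfl fun _ _ => Finset.sum_congr rfl fun _ _ => by ring
    have e2 : ∑ i ∈ I, a i * (θ * ∑ q ∈ Q i, c q * act (f q) (v i))
        = θ * ∑ q, c q * ∑ i ∈ I, (if q ∈ Q i then a i * act (f q) (v i) else 0) := by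
      simp only [Finset.mul_sum]
      rw [Finset.sum_comm]
      refine Finset.sum_congr rfl fun i _ => ?_
      rw [← Finset.sum_subset (Finset.subset_univ (Q i)) fun q _ hq => by simp [hq]]
      exact Finset.sum_congr rfl fun q hq => by rw [if_pos hq]; ring
    rw [e1, e2, ← mul_add, ← Finset.sum_add_distrib]
    simp_rw [← mul_add, ← hpt]
  -- Part of a functional, with coefficients rescaled to the unit sphere, is still bounded by `1` on
  -- each `v i`; undoing the scaling gives the `ℓ_{r'}` norm of the coefficients used.
  have hnorm : ∀ (S : Finset (Fin d)) i,
      |θ * ∑ q ∈ S, c q * act (f q) (v i)| ≤ finLpNorm r.conjExponent S c := by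
    intro S i
    rcases (finLpNorm.nonneg r.conjExponent S c).eq_or_lt with h0 | hpos
    · have : ∀ q ∈ S, c q * act (f q) (v i) = 0 := fun q hq => by
        have := finLpNorm.abs_le (a := c) hr' hq
        rw [← h0] at this
        rw [abs_nonpos_iff.mp this, zero_mul]
      rw [Finset.sum_eq_zero this, mul_zero, abs_zero, ← h0]
    · set M := finLpNorm r.conjExponent S c
      have := hW S (fun q => M⁻¹ * c q)
        (by rw [finLpNorm.mul_left hr', abs_of_pos (inv_pos.mpr hpos), inv_mul_cancel₀ hpos.ne']) i
      have e : θ * ∑ q ∈ S, M⁻¹ * c q * act (f q) (v i)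
          = M⁻¹ * (θ * ∑ q ∈ S, c q * act (f q) (v i)) := by
        simp only [Finset.mul_sum]
        exact Finset.sum_congr rfl fun _ _ => by ring
      rwa [e, abs_mul, abs_of_pos (inv_pos.mpr hpos), inv_mul_le_iff₀ hpos, mul_one] at this
  have hfirst : |∑ i ∈ I, a i * (θ * ∑ q ∈ Q i, c q * act (f q) (v i))| ≤ finLpNorm p I a :=
    calc |∑ i ∈ I, a i * (θ * ∑ q ∈ Q i, c q * act (f q) (v i))|
        ≤ ∑ i ∈ I, |a i| * |finLpNorm r.conjExponent (Q i) c| := by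
          refine (Finset.abs_sum_le_sum_abs _ _).trans (Finset.sum_le_sum fun i _ => ?_)
          rw [abs_mul, abs_of_nonneg (finLpNorm.nonneg _ _ _)]
          exact mul_le_mul_of_nonneg_left (hnorm _ _) (abs_nonneg _)
      _ ≤ finLpNorm r I a
          * finLpNorm r.conjExponent I fun i => finLpNorm r.conjExponent (Q i) c :=
          finLpNorm.holder hr
      _ ≤ finLpNorm r I a * 1 := by
          refine mul_le_mul_of_nonneg_left ?_ (finLpNorm.nonneg _ _ _)
          exact (finLpNorm.disjoint_pieces hr' (fun i _ => Finset.subset_univ (Q i)) hQdisj).trans hc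
      _ ≤ finLpNorm p I a := by
          rw [mul_one]
          exact finLpNorm.antitone hp hpr
  have hsecond : |∑ q, c q * ∑ i ∈ J q, a i * act (f q) (v i)| ≤ 4 * finLpNorm p I a :=
    calc |∑ q, c q * ∑ i ∈ J q, a i * act (f q) (v i)|
        ≤ ∑ q, 4 * (|finLpNorm p (J q) a| * |c q|) := by
          refine (Finset.abs_sum_le_sum_abs _ _).trans (Finset.sum_le_sum fun q _ => ?_)
          rw [abs_mul, abs_of_nonneg (finLpNorm.nonneg _ _ _), ← mul_assoc, mul_comm]
          exact mul_le_mul_of_nonneg_right (ih q _ (hJI q)) (abs_nonneg _)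
      _ = 4 * ∑ q, |finLpNorm p (J q) a| * |c q| := by rw [Finset.mul_sum]
      _ ≤ 4 * (finLpNorm p Finset.univ (fun q => finLpNorm p (J q) a)
            * finLpNorm p.conjExponent Finset.univ c) := by
          gcongr
          exact finLpNorm.holder hp
      _ ≤ 4 * (finLpNorm p I a * 1) := by
          have h1 := finLpNorm.disjoint_pieces (a := a) hp (fun q _ => hJI q) hJdisj
          have h2 : finLpNorm p.conjExponent Finset.univ c ≤ 1 :=
            (finLpNorm.antitone hr' (finLpNorm.conjExponent_antitone hpr)).trans hc
          gcongr
          exacts [finLpNorm.nonneg _ _ _, finLpNorm.nonneg _ _ _]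
      _ = _ := by rw [mul_one]
  have hM := finLpNorm.nonneg p I a
  rw [hsum]
  refine (abs_add_le _ _).trans ?_
  rw [abs_mul θ, abs_of_pos hθ0]
  -- The total is at most `(1 + 4θ) ‖a‖_p ≤ 2 ‖a‖_p`.
  nlinarith [mul_le_mul hθ hsecond (abs_nonneg _) (by norm_num)]

/-- Very fast growing families of functionals that are negligible on sparse vectors. -/
lemma fast_estimate {v : ℕ → ℕ+ →₀ ℝ} {θ : ℝ}
    (hθ0 : 0 < θ) (hθ : θ ≤ 1 / 4) {d : ℕ} {f : Fin d → ℕ+ →₀ ℝ} {s : Fin d → ℕ}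
    (hf : VeryFastGrowing f s) (hadm : ∀ q, ∀ i ∈ (f q).support, d ≤ (i : ℕ)) {c : Fin d → ℝ}
    (hc : ∀ q, |c q| ≤ 1) (hsmall : ∀ q t i i', t < i → t < i' →
      ∀ j ∈ (v i).support, (j : ℕ) < s q → ∀ m ∈ (v t).support,
        |act (f q) (v i')| * ((m : ℕ) * (t + 1)) ≤ 1)
    (hW : ∀ i, |θ * ∑ q, c q * act (f q) (v i)| ≤ 1)
    (I : Finset ℕ) (hI : ∀ i ∈ I, I.card ≤ i + 1) (a : ℕ → ℝ) {M : ℝ}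
    (haM : ∀ i ∈ I, |a i| ≤ M) (hM : 0 ≤ M)
    (ih : ∀ q, ∀ I' ⊆ I, |∑ i ∈ I', a i * act (f q) (v i)| ≤ 4 * M) :
    |∑ i ∈ I, a i * (θ * ∑ q, c q * act (f q) (v i))| ≤ 4 * M := by
  classical
  by_cases hne : ∃ i ∈ I, ∃ q, act (f q) (v i) ≠ 0
  swap
  · push Not at hne
    rw [Finset.sum_eq_zero fun i hi => by
      rw [Finset.sum_eq_zero fun q _ => by rw [hne i hi q, mul_zero], mul_zero, mul_zero],
      abs_zero]
    linarith
  let B := I.filter fun i => ∃ q, act (f q) (v i) ≠ 0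
  have hB : B.Nonempty := by
    obtain ⟨i, hi, hq⟩ := hne
    exact ⟨i, Finset.mem_filter.mpr ⟨hi, hq⟩⟩
  -- `i₁` is the first vector met by any component. It is paid for by `hW`, and its support supplies
  -- the coordinate `m` that bounds `d`.
  set i₁ := B.min' hB
  obtain ⟨hi₁I, q₀, hq₀⟩ := Finset.mem_filter.mp (B.min'_mem hB)
  have hi₁ : ∀ i ∈ I, i < i₁ → ∀ q, act (f q) (v i) = 0 := fun i hi hlt q => by
    by_contra h
    exact absurd (B.min'_le i (Finset.mem_filter.mpr ⟨hi, q, h⟩)) (not_le.mpr hlt)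
  let I' := I.filter fun i => i₁ < i
  have hI' : I' ⊆ I := Finset.filter_subset _ _
  have hsplit : ∑ i ∈ I, a i * (θ * ∑ q, c q * act (f q) (v i))
      = a i₁ * (θ * ∑ q, c q * act (f q) (v i₁))
        + θ * ∑ q, c q * ∑ i ∈ I', a i * act (f q) (v i) := by
    have e1 : θ * ∑ q, c q * ∑ i ∈ I', a i * act (f q) (v i)
        = ∑ i ∈ I', a i * (θ * ∑ q, c q * act (f q) (v i)) := by
      simp only [Finset.mul_sum]
      rw [Finset.sum_comm]
      exact Finset.sum_congr rfl fun _ _ => Finset.sum_congr rfl fun _ _ => by ring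
    rw [e1, ← Finset.sum_insert (s := I') (a := i₁)
      (f := fun i => a i * (θ * ∑ q, c q * act (f q) (v i))) (by simp [I'])]
    refine (Finset.sum_subset (Finset.insert_subset hi₁I hI') fun i hi hi' => ?_).symm
    have hlt : i < i₁ := by
      by_contra h
      rcases (not_lt.mp h).eq_or_lt with h | h
      · exact hi' (by rw [← h]; exact Finset.mem_insert_self _ _)
      · exact hi' (Finset.mem_insert_of_mem (Finset.mem_filter.mpr ⟨hi, h⟩))
    rw [Finset.sum_eq_zero fun q _ => by rw [hi₁ i hi hlt q, mul_zero], mul_zero, mul_zero]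
  have hfirst : |a i₁ * (θ * ∑ q, c q * act (f q) (v i₁))| ≤ M := by
    rw [abs_mul]
    exact (mul_le_of_le_one_right (abs_nonneg _) (hW i₁)).trans (haM _ hi₁I)
  -- With `θ ≤ 1/4` the total is then at most `M + (5/4) M`, which is below `4 M`.
  suffices hsecond : |∑ q, c q * ∑ i ∈ I', a i * act (f q) (v i)| ≤ 5 * M by
    rw [hsplit]
    refine (abs_add_le _ _).trans ?_
    rw [abs_mul θ, abs_of_pos hθ0]
    nlinarith [mul_le_mul hθ hsecond (abs_nonneg _) (by norm_num)]
  let R := Finset.univ.filter fun q => ∃ i ∈ I', act (f q) (v i) ≠ 0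
  have hzero : ∀ q, q ∉ R → ∑ i ∈ I', a i * act (f q) (v i) = 0 := fun q hq => by
    refine Finset.sum_eq_zero fun i hi => ?_
    by_contra h
    exact hq (Finset.mem_filter.mpr ⟨Finset.mem_univ _, i, hi, right_ne_zero_of_mul h⟩)
  by_cases hR : R.Nonempty
  swap
  · rw [Finset.sum_eq_zero fun q _ => by
      rw [hzero q fun h => hR ⟨q, h⟩, mul_zero], abs_zero]
    linarith
  -- `q₁` is the first component acting beyond `i₁`; it alone uses the induction hypothesis. Each
  -- later component has size above a coordinate `j` of `f q₁` lying in the support of `v i₂`, so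
  -- sparseness makes it negligible.
  set q₁ := R.min' hR
  obtain ⟨-, i₂, hi₂, hact₂⟩ := Finset.mem_filter.mp (R.min'_mem hR)
  obtain ⟨j, hjf, hjv⟩ := exists_mem_of_act_ne_zero hact₂
  obtain ⟨m, hmf, hmv⟩ := exists_mem_of_act_ne_zero hq₀
  have hdm : (d : ℝ) ≤ (m : ℕ) := by exact_mod_cast hadm q₀ m hmf
  have hm0 : (0 : ℝ) < (m : ℕ) := by exact_mod_cast m.pos
  have hcard : ((I'.card : ℕ) : ℝ) ≤ i₁ + 1 := by
    exact_mod_cast (Finset.card_le_card hI').trans (hI i₁ hi₁I)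
  -- At most `i₁ + 1` vectors remain, each contributing at most `M / (m (i₁ + 1))`. Admissibility
  -- gives `d ≤ m`, so fewer than `d` such components cost at most `M` in total.
  have hterm : ∀ q, q ≠ q₁ → |c q * ∑ i ∈ I', a i * act (f q) (v i)| ≤ M / (m : ℕ) := by
    intro q hq
    by_cases hqR : q ∈ R
    swap
    · rw [hzero q hqR, mul_zero, abs_zero]
      positivity
    have hlt : q₁ < q := lt_of_le_of_ne (R.min'_le q hqR) (Ne.symm hq)
    have hjs : (j : ℕ) < s q := (hf.2 q₁ q hlt j hjf).2
    have hsm : ∀ i ∈ I', |act (f q) (v i)| ≤ 1 / ((m : ℕ) * (i₁ + 1)) := fun i hi => by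
      rw [le_div_iff₀ (by positivity)]
      exact hsmall q i₁ i₂ i (Finset.mem_filter.mp hi₂).2 (Finset.mem_filter.mp hi).2 j hjv hjs
        m hmv
    rw [abs_mul]
    calc |c q| * |∑ i ∈ I', a i * act (f q) (v i)|
        ≤ 1 * ∑ i ∈ I', M * (1 / ((m : ℕ) * (i₁ + 1))) := by
          refine mul_le_mul (hc q) ((Finset.abs_sum_le_sum_abs _ _).trans
            (Finset.sum_le_sum fun i hi => ?_)) (abs_nonneg _) zero_le_one
          rw [abs_mul]
          exact mul_le_mul (haM i (hI' hi)) (hsm i hi) (abs_nonneg _) hM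
      _ = I'.card * (M / ((m : ℕ) * (i₁ + 1))) := by
          rw [one_mul, Finset.sum_const, nsmul_eq_mul, mul_one_div]
      _ ≤ (i₁ + 1) * (M / ((m : ℕ) * (i₁ + 1))) := by gcongr
      _ = M / (m : ℕ) := by field_simp
  rw [← Finset.add_sum_erase _ _ (Finset.mem_univ q₁)]
  refine (abs_add_le _ _).trans ?_
  have h1 : |c q₁ * ∑ i ∈ I', a i * act (f q₁) (v i)| ≤ 4 * M := by
    rw [abs_mul]
    exact (mul_le_of_le_one_left (abs_nonneg _) (hc q₁)).trans (ih q₁ I' hI')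
  have h2 : |∑ q ∈ Finset.univ.erase q₁, c q * ∑ i ∈ I', a i * act (f q) (v i)| ≤ M :=
    calc |∑ q ∈ Finset.univ.erase q₁, c q * ∑ i ∈ I', a i * act (f q) (v i)|
        ≤ ∑ q ∈ Finset.univ.erase q₁, M / (m : ℕ) :=
          (Finset.abs_sum_le_sum_abs _ _).trans (Finset.sum_le_sum fun q hq =>
            hterm q (Finset.ne_of_mem_erase hq))
      _ = (Finset.univ.erase q₁).card * (M / (m : ℕ)) := by rw [Finset.sum_const, nsmul_eq_mul]
      _ ≤ (m : ℕ) * (M / (m : ℕ)) := by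
          have : ((Finset.univ.erase q₁).card : ℝ) ≤ d := by
            exact_mod_cast (Finset.card_le_univ _).trans_eq (Fintype.card_fin d)
          exact mul_le_mul_of_nonneg_right (this.trans hdm) (by positivity)
      _ = M := mul_div_cancel₀ _ hm0.ne'
  linarith

/-- Induction on how `f` is built. Components of order at least `K`, or zero, have coefficients in
the dual ball of an exponent at least `p K` and fall under `split_estimate`. For order `k < K` the
components have order `o` with `o + 1 < K`, so sparseness applies and `fast_estimate` even needs
only the maximum of `|a i|` for its direct terms. -/
theorem upper_estimate {P : SpaceData} {v : ℕ → ℕ+ →₀ ℝ} (hv : Successive v)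
    (hv1 : ∀ f ∈ P.normingSet, ∀ i, |act f (v i)| ≤ 1) {K : ℕ} (hK : 1 ≤ K) (hKξ : K ≤ P.ξ₀)
    (hsparse : P.Sparse K v) {ℓ : Label} {f : ℕ+ →₀ ℝ} (hf : P.IsNorming ℓ f) (a : ℕ → ℝ)
    (I : Finset ℕ) (hI : ∀ i ∈ I, I.card ≤ i + 1) :
    |∑ i ∈ I, a i * act f (v i)| ≤ 4 * finLpNorm (P.p K) I a := by
  classical
  have hK' : (1 : ℕ∞) ≤ K := by exact_mod_cast hK
  have hp := P.one_le_exponent hK' hKξ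
  have hsub : ∀ {I I' : Finset ℕ}, (∀ i ∈ I, I.card ≤ i + 1) → I' ⊆ I →
      ∀ i ∈ I', I'.card ≤ i + 1 := fun h hs i hi => (Finset.card_le_card hs).trans (h i (hs hi))
  have hzero : ∀ {d : ℕ} (f : Fin d → ℕ+ →₀ ℝ) (I : Finset ℕ), (∀ q, f q ∈ P.normingSet) →
      Successive f → ∀ c : Fin d → ℝ, finLpNorm (P.p P.ξ₀).conjExponent Finset.univ c ≤ 1 →
      (∀ q, ∀ I' ⊆ I, |∑ i ∈ I', a i * act (f q) (v i)| ≤ 4 * finLpNorm (P.p K) I' a) →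
      |∑ i ∈ I, a i * (P.θ * ∑ q, c q * act (f q) (v i))| ≤ 4 * finLpNorm (P.p K) I a := by
    intro d f I hf hs c hc ih
    refine split_estimate hv hp (P.exponent_mono hK' hKξ le_rfl) P.θ_pos P.θ_le hs hc
      (fun S c' hc' i => ?_) I a ih
    rcases S.eq_empty_or_nonempty with rfl | hS
    · simp
    have := hS.to_subtype
    have h := hv1 _ ⟨_, isNorming_orderZero (fun q : S => hf q)
      (hs.comp (Subtype.strictMono_coe _)) (by rwa [finLpNorm_coe_sort])⟩ i
    rwa [act_combination, Finset.sum_coe_sort S fun q => c' q * act (f q) (v i)] at h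
  induction hf generalizing I with
  | basis j ε hε =>
    have hmem := finLpNorm.nonneg (P.p K) I a
    have hb : ∀ i, |act (Finsupp.single j ε) (v i)| ≤ 1 := hv1 _ ⟨_, IsNorming.basis j ε hε⟩
    have hsupp : ∀ i, act (Finsupp.single j ε) (v i) ≠ 0 → j ∈ (v i).support := fun i h => by
      obtain ⟨m, hm, hm'⟩ := exists_mem_of_act_ne_zero h
      rwa [← Finset.mem_singleton.mp (Finsupp.support_single_subset hm)]
    by_cases h : ∃ i ∈ I, j ∈ (v i).support
    · obtain ⟨i, hi, hj⟩ := h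
      rw [Finset.sum_eq_single i]
      · rw [abs_mul]
        refine (mul_le_of_le_one_right (abs_nonneg _) (hb i)).trans
          ((finLpNorm.abs_le hp hi).trans ?_)
        linarith
      · intro i' _ hne
        by_contra h0
        have hj' := hsupp i' (right_ne_zero_of_mul h0)
        rcases lt_or_gt_of_ne hne with hl | hl
        · exact lt_irrefl j (hv.2 _ _ hl j hj' j hj)
        · exact lt_irrefl j (hv.2 _ _ hl j hj j hj')
      · exact fun h => absurd hi h
    · rw [Finset.sum_eq_zero, abs_zero]
      · linarith
      · intro i hi
        by_contra h0
        exact h ⟨i, hi, hsupp i (right_ne_zero_of_mul h0)⟩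
  | orderZero hd f ℓ c hf hsucc hc ih =>
    simp only [act_combination]
    rw [inUnitBall_iff (one_le_conjExponent _)] at hc
    exact hzero f I (fun q => ⟨_, hf q⟩) hsucc c hc fun q I' hI' => ih q I' (hsub hI hI')
  | orderZeroSized hd f ℓ n hf hsucc hdn ih =>
    simp only [act_combination]
    refine hzero f I (fun q => ⟨_, hf q⟩) hsucc _ ?_ fun q I' hI' => ih q I' (hsub hI hI')
    have hn : (0 : ℝ) < n := by exact_mod_cast hd.trans_le hdn
    -- As `p_{ξ₀} > 1`, the conjugate exponent is finite, and the coefficients have power sum `d / n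
    -- ≤ 1`.
    have hr := finLpNorm.conjExponent_ne_top P.one_lt_exponent_ξ₀
    have hr1 := finLpNorm.toReal_ge_one (one_le_conjExponent _) hr
    rw [finLpNorm.le_iff zero_le_one (one_le_conjExponent _) hr, Real.one_rpow,
      abs_of_nonneg (by positivity), one_div ((P.p P.ξ₀).conjExponent.toReal),
      Real.rpow_inv_rpow (by positivity) (by linarith), Finset.sum_const, Finset.card_univ,
      Fintype.card_fin, nsmul_eq_mul, mul_one_div, div_le_one hn]
    exact_mod_cast hdn
  | orderPos k hk hkξ f o s c n hf ho hadm hfast hc hn ih =>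
    simp only [act_combination]
    have hc' := abs_le_one_of_inUnitBall (one_le_conjExponent _) hc
    rcases lt_or_ge k K with hkK | hkK
    · refine fast_estimate P.θ_pos P.θ_le hfast hadm.2 hc' (fun q t i i' hi hi' j hj hjs m hm =>
        hsparse (f q) (o q) (s q) (hf q) (by have := ho q; omega) t i i' hi hi' j hj hjs m hm)
        (fun i => ?_) I hI a (fun i hi => finLpNorm.abs_le hp hi) (finLpNorm.nonneg _ _ _)
        fun q I' hI' => (ih q I' (hsub hI hI')).trans ?_
      · have h := hv1 _ ⟨_, IsNorming.orderPos k hk hkξ f o s c n hf ho hadm hfast hc hn⟩ i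
        rwa [act_combination] at h
      · have := finLpNorm.mono (a := a) (b := a) hp hI' fun _ _ => le_rfl
        linarith
    · rw [inUnitBall_iff (one_le_conjExponent _)] at hc
      refine split_estimate hv hp (P.exponent_mono hK' (by exact_mod_cast hkK) hkξ.le) P.θ_pos
        P.θ_le hadm.1 hc (fun S c' hc' i => ?_) I a fun q I' hI' => ih q I' (hsub hI hI')
      rcases S.eq_empty_or_nonempty with rfl | hS
      · simp
      have := hS.to_subtype
      obtain ⟨q₀, h⟩ := isNorming_orderPos (κ := S) hk hkξ (fun q => hf q) (fun q => ho q)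
        (hfast.comp (Subtype.strictMono_coe _)) (fun q i hi => by
          rw [Fintype.card_coe]
          exact ((Finset.card_le_univ S).trans_eq (Fintype.card_fin _)).trans (hadm.2 q i hi))
        (c := fun q => c' q) (by rwa [finLpNorm_coe_sort])
      have h := hv1 _ ⟨_, h⟩ i
      rwa [act_combination, Finset.sum_coe_sort S fun q => c' q * act (f q) (v i)] at h

end SpaceData

/-! ### Spreading models equivalent to the unit vector basis of `ℓ_p` -/

/-- On constant vectors the two norms are `n^{1/p}` and `n^{1/q}`, and their ratio is unbounded. -/
lemma finLpNorm.exists_mul_lt {p q : ℝ≥0∞} (hp : 1 ≤ p) (hpq : p < q) (D : ℝ) :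
    ∃ n : ℕ, D * finLpNorm q Finset.univ (fun _ : Fin n => 1)
      < finLpNorm p Finset.univ (fun _ : Fin n => 1) := by
  have hpos : 0 < p⁻¹.toReal - q⁻¹.toReal := by
    rw [sub_pos]
    exact (ENNReal.toReal_lt_toReal (by simp [(zero_lt_one.trans_le (hp.trans hpq.le)).ne'])
      (by simp [(zero_lt_one.trans_le hp).ne'])).mpr (ENNReal.inv_lt_inv.mpr hpq)
  have hlim := (tendsto_rpow_atTop hpos).comp tendsto_natCast_atTop_atTop
  obtain ⟨n, hn, hn0⟩ := ((hlim.eventually_gt_atTop D).and (eventually_gt_atTop 0)).exists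
  have : Nonempty (Fin n) := ⟨⟨0, hn0⟩⟩
  have hn' : (0 : ℝ) < n := by exact_mod_cast hn0
  refine ⟨n, ?_⟩
  rw [const_one hp Finset.univ_nonempty, const_one (hp.trans hpq.le) Finset.univ_nonempty,
    Finset.card_univ, Fintype.card_fin]
  have e : (n : ℝ) ^ p⁻¹.toReal = (n : ℝ) ^ (p⁻¹.toReal - q⁻¹.toReal) * (n : ℝ) ^ q⁻¹.toReal := by
    rw [← Real.rpow_add hn', sub_add_cancel]
  rw [e]
  exact mul_lt_mul_of_pos_right hn (Real.rpow_pos_of_pos hn' _)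

lemma seqEquivalent_lpUnitVector {E : Type*} [NormedAddCommGroup E] [NormedSpace ℝ E] {e : ℕ → E}
    {p : ℝ≥0∞} (hp : 1 ≤ p) {c C : ℝ} (hc : 0 < c) (hC : 0 ≤ C)
    (hlow : ∀ (n : ℕ) (a : Fin n → ℝ), c * finLpNorm p Finset.univ a ≤ ‖∑ i, a i • e i‖)
    (hup : ∀ (n : ℕ) (a : Fin n → ℝ), ‖∑ i, a i • e i‖ ≤ C * finLpNorm p Finset.univ a) :
    SeqEquivalent e (lpUnitVector p) := by
  have hpos : 0 < 1 + C + c⁻¹ := by positivity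
  have hc' : 0 < c⁻¹ := inv_pos.mpr hc
  -- A square, since equivalence is stated with `√C`; the base dominates `1`, `C` and `c⁻¹`.
  refine ⟨(1 + C + c⁻¹) ^ 2, one_le_pow₀ (by linarith), fun n a => ?_⟩
  rw [Real.sqrt_sq hpos.le, finLpNorm.norm_sum_lpUnitVector hp]
  have h0 := finLpNorm.nonneg p Finset.univ a
  constructor
  · rw [inv_mul_le_iff₀ hpos]
    refine (hup n a).trans (mul_le_mul_of_nonneg_right ?_ h0)
    linarith
  · have h1 : finLpNorm p Finset.univ a ≤ c⁻¹ * ‖∑ i, a i • e i‖ := by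
      rw [inv_mul_eq_div, le_div_iff₀ hc, mul_comm]
      exact hlow n a
    refine h1.trans (mul_le_mul_of_nonneg_right ?_ (norm_nonneg _))
    linarith

lemma SeqEquivalent.exists_bounds {E : Type*} [NormedAddCommGroup E] [NormedSpace ℝ E] {e : ℕ → E}
    {p : ℝ≥0∞} (hp : 1 ≤ p) (h : SeqEquivalent e (lpUnitVector p)) :
    ∃ D : ℝ, 0 < D ∧ ∀ (n : ℕ) (a : Fin n → ℝ),
      ‖∑ i, a i • e i‖ ≤ D * finLpNorm p Finset.univ a ∧
      finLpNorm p Finset.univ a ≤ D * ‖∑ i, a i • e i‖ := by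
  obtain ⟨C, hC, h⟩ := h
  have hpos : 0 < √C := Real.sqrt_pos.mpr (by linarith)
  refine ⟨√C, hpos, fun n a => ?_⟩
  have := h n a
  rwa [finLpNorm.norm_sum_lpUnitVector hp, inv_mul_le_iff₀ hpos] at this

namespace SpaceData

/-! ### Estimates for spreading models and the exponents they determine. -/

section SpreadingModels

variable {P : SpaceData} {u : ℕ → P.C00} {x : ℕ → P.X} {E : Type*} [NormedAddCommGroup E]
  [NormedSpace ℝ E] {e : ℕ → E}

/-- Iterated limits do not change along a subsequence, so a sparse one may be used. Tuples with `n ≤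
t i` have index sets small enough for `upper_estimate`. -/
lemma IsNormalizedBlock.spreadingModel_upper_nat (hx : P.IsNormalizedBlock u x)
    (he : IsSpreadingModel e x) {K : ℕ} (hK : 1 ≤ K) (hKξ : (K : ℕ∞) ≤ P.ξ₀)
    (hα : ∀ k, 1 ≤ k → k < K → P.AlphaIndexZero k u) (n : ℕ) (a : Fin n → ℝ) :
    ‖∑ i, a i • e i‖ ≤ 4 * finLpNorm (P.p K) Finset.univ a := by
  obtain ⟨φ, hφ, hsparse⟩ := hx.exists_sparse hα
  refine ((he.2.2 n a).comp hφ.tendsto_atTop).mono (IteratedLim.const n _) n fun t ht hnt => ?_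
  have hx' := hx.comp hφ
  refine (hx'.norm_sum Finset.univ a t).trans_le (P.norm_le_of_forall_act fun f hf => ?_)
  let ι : Fin n ↪ ℕ := ⟨t, ht.injective⟩
  have hext : ∀ i, Function.extend t a 0 (ι i) = a i := fun i => ht.injective.extend_apply a 0 i
  obtain ⟨ℓ, hℓ⟩ := hf
  have key := upper_estimate (v := fun i => u (φ i)) hx'.2.1
    (fun g hg i => hx'.abs_act_le_one hg i) hK hKξ hsparse hℓ (Function.extend t a 0)
    (Finset.univ.map ι) (fun i hi => by
      obtain ⟨j, -, rfl⟩ := Finset.mem_map.mp hi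
      rw [Finset.card_map, Finset.card_univ, Fintype.card_fin]
      exact (hnt j).trans (Nat.le_succ _))
  rw [Finset.sum_map, finLpNorm.map] at key
  simp only [hext] at key
  rw [act_sum]
  exact key

lemma IsNormalizedBlock.spreadingModel_upper (hx : P.IsNormalizedBlock u x)
    (he : IsSpreadingModel e x) {ζ : ℕ∞} (hζ : 1 ≤ ζ) (hζξ : ζ ≤ P.ξ₀)
    (hα : ∀ k : ℕ, 1 ≤ k → (k : ℕ∞) < ζ → P.AlphaIndexZero k u) (n : ℕ) (a : Fin n → ℝ) :
    ‖∑ i, a i • e i‖ ≤ 4 * finLpNorm (P.p ζ) Finset.univ a := by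
  induction ζ using ENat.recTopCoe with
  | coe K =>
    exact hx.spreadingModel_upper_nat he (by exact_mod_cast hζ) hζξ
      (fun k hk hkK => hα k hk (by exact_mod_cast hkK)) n a
  | top =>
    have hξ : P.ξ₀ = ⊤ := top_le_iff.mp hζξ
    rcases n.eq_zero_or_pos with rfl | hn
    · simpa using finLpNorm.nonneg _ _ _
    have hp0 : ∀ {η : ℕ∞}, 1 ≤ η → P.p η ≠ 0 := fun hη =>
      (zero_lt_one.trans_le (P.one_le_exponent hη (by rw [hξ]; exact le_top))).ne'
    -- For `ζ = ω` the estimate holds for every finite `k`. Comparing `ℓ_{p_k}` with `ℓ_{p_ω}` on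
    -- `n` coordinates costs `n ^ (1/p_k - 1/p_ω)`, which tends to `1`.
    have hlim : Tendsto (fun k : ℕ => (P.p k)⁻¹.toReal - (P.p ⊤)⁻¹.toReal) atTop (𝓝 0) := by
      rw [← sub_self (P.p ⊤)⁻¹.toReal]
      refine Tendsto.sub_const ?_ _
      exact (ENNReal.tendsto_toReal (by simp [hp0 hζ])).comp
        (_root_.tendsto_inv_iff.mpr (P.p_tendsto hξ))
    have hn0 : ((Finset.univ : Finset (Fin n)).card : ℝ) ≠ 0 := by
      rw [Finset.card_univ, Fintype.card_fin]
      exact_mod_cast hn.ne'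
    have hlim2 : Tendsto (fun k : ℕ => 4 * (((Finset.univ : Finset (Fin n)).card : ℝ)
        ^ ((P.p k)⁻¹.toReal - (P.p ⊤)⁻¹.toReal) * finLpNorm (P.p ⊤) Finset.univ a)) atTop
        (𝓝 (4 * (((Finset.univ : Finset (Fin n)).card : ℝ) ^ (0 : ℝ)
          * finLpNorm (P.p ⊤) Finset.univ a))) :=
      (((Real.continuousAt_const_rpow hn0).tendsto.comp hlim).mul_const _).const_mul _
    rw [Real.rpow_zero, one_mul] at hlim2
    refine ge_of_tendsto hlim2 ?_
    filter_upwards [eventually_ge_atTop 1] with k hk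
    have hk' : (1 : ℕ∞) ≤ k := by exact_mod_cast hk
    have h1 := hx.spreadingModel_upper_nat he hk (hξ ▸ le_top)
      (fun k' hk' _ => hα k' hk' (ENat.natCast_lt_top k')) n a
    have h2 := finLpNorm.le_card_rpow_mul (s := Finset.univ) (a := a)
      (P.one_le_exponent hk' (hξ ▸ le_top)) (P.exponent_mono hk' le_top hξ.ge)
    linarith

lemma IsNormalizedBlock.spreadingModel_lower (hx : P.IsNormalizedBlock u x)
    (he : IsSpreadingModel e x) (n : ℕ) (a : Fin n → ℝ) :
    P.θ * (1 / 2) * finLpNorm (P.p P.ξ₀) Finset.univ a ≤ ‖∑ i, a i • e i‖ :=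
  (IteratedLim.const n _).mono (he.2.2 n a) 0 fun t ht _ =>
    (hx.lower_estimate ht a).trans_eq (hx.norm_sum Finset.univ a t).symm

/-- A subsequence of which all spreading models have a lower `ℓ_{p_k}` estimate. -/
lemma IsNormalizedBlock.exists_spreadingModel_lower (hx : P.IsNormalizedBlock u x) {k : ℕ}
    (hk : 1 ≤ k) (hkξ : (k : ℕ∞) < P.ξ₀) (hα : P.AlphaIndexPos k u) :
    ∃ φ : ℕ → ℕ, StrictMono φ ∧ ∃ δ : ℝ, 0 < δ ∧ ∀ ψ : ℕ → ℕ, StrictMono ψ →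
      ∀ (E : Type) [NormedAddCommGroup E] [NormedSpace ℝ E] (e : ℕ → E),
        IsSpreadingModel e (x ∘ φ ∘ ψ) → ∀ (n : ℕ) (a : Fin n → ℝ),
          δ * finLpNorm (P.p k) Finset.univ a ≤ ‖∑ i, a i • e i‖ := by
  obtain ⟨φ, hφ, δ, hδ, h⟩ := hx.exists_lower_estimate_of_alphaIndexPos hk hkξ hα
  refine ⟨φ, hφ, δ, hδ, fun ψ hψ E _ _ e he n a => ?_⟩
  refine (IteratedLim.const n _).mono (he.2.2 n a) n fun t ht hnt => ?_
  exact (h n (fun i => ψ (t i)) (hψ.comp ht) (fun i => (hnt i).trans (hψ.id_le _)) a).trans_eq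
    ((hx.comp (hφ.comp hψ)).norm_sum Finset.univ a t).symm

lemma IsNormalizedBlock.exists_subseq_spreadingModel (hx : P.IsNormalizedBlock u x) :
    ∃ φ : ℕ → ℕ, StrictMono φ ∧ ∃ (E : Type) (_ : NormedAddCommGroup E) (_ : NormedSpace ℝ E)
      (_ : CompleteSpace E) (e : ℕ → E), IsSpreadingModel e (x ∘ φ) := by
  obtain ⟨φ, hφ, hlim⟩ := exists_subseq_iteratedLim x fun j => (hx.2.2 j).le
  exact ⟨φ, hφ, exists_isSpreadingModel (hx.comp hφ).isSuppressionUnconditional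
    (fun j => hx.2.2 _) hlim⟩

lemma IsNormalizedBlock.hasSubseqGeneratingLp_of_alphaIndexPos (hx : P.IsNormalizedBlock u x)
    {k : ℕ} (hk : 1 ≤ k) (hkξ : (k : ℕ∞) < P.ξ₀) (hα : P.AlphaIndexPos k u)
    (hα' : ∀ k', 1 ≤ k' → k' < k → P.AlphaIndexZero k' u) :
    HasSubseqGeneratingLp (P.p k) x := by
  obtain ⟨φ, hφ, δ, hδ, hlow⟩ := hx.exists_spreadingModel_lower hk hkξ hα
  obtain ⟨ψ, hψ, E, _, _, _, e, he⟩ := (hx.comp hφ).exists_subseq_spreadingModel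
  have hk' : (1 : ℕ∞) ≤ k := by exact_mod_cast hk
  refine ⟨φ ∘ ψ, hφ.comp hψ, E, inferInstance, inferInstance, inferInstance, e, he,
    seqEquivalent_lpUnitVector (P.one_le_exponent hk' hkξ.le) hδ (by norm_num : (0 : ℝ) ≤ 4)
      (hlow ψ hψ E e he) fun n a => ?_⟩
  exact (hx.comp (hφ.comp hψ)).spreadingModel_upper_nat he hk hkξ.le
    (fun k' h1 h2 => (hα' k' h1 h2).comp (hφ.comp hψ)) n a

lemma IsNormalizedBlock.hasSubseqGeneratingLp_of_alphaIndexZero (hx : P.IsNormalizedBlock u x)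
    (hα : ∀ k : ℕ, 1 ≤ k → (k : ℕ∞) < P.ξ₀ → P.AlphaIndexZero k u) :
    HasSubseqGeneratingLp (P.p P.ξ₀) x := by
  obtain ⟨φ, hφ, E, _, _, _, e, he⟩ := hx.exists_subseq_spreadingModel
  exact ⟨φ, hφ, E, inferInstance, inferInstance, inferInstance, e, he,
    seqEquivalent_lpUnitVector (P.one_le_exponent P.one_le_ξ₀ le_rfl)
      (mul_pos P.θ_pos (by norm_num)) (by norm_num : (0 : ℝ) ≤ 4)
      ((hx.comp hφ).spreadingModel_lower he)
      ((hx.comp hφ).spreadingModel_upper he P.one_le_ξ₀ le_rfl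
        fun k h1 h2 => (hα k h1 h2).comp hφ)⟩

/-- All spreading models of subsequences are dominated by `ℓ_{p_ζ}`, whose norm grows too slowly on
constant vectors for an `ℓ_{p_η}` model with `η < ζ`. -/
lemma IsNormalizedBlock.not_hasSubseqGeneratingLp (hx : P.IsNormalizedBlock u x) {ζ η : ℕ∞}
    (hη : 1 ≤ η) (hηζ : η < ζ) (hζ : ζ ≤ P.ξ₀)
    (hα : ∀ k : ℕ, 1 ≤ k → (k : ℕ∞) < ζ → P.AlphaIndexZero k u) :
    ¬ HasSubseqGeneratingLp (P.p η) x := by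
  rintro ⟨φ, hφ, E, _, _, _, e, he, heq⟩
  have hp := P.one_le_exponent hη (hηζ.le.trans hζ)
  obtain ⟨D, hD, hbd⟩ := heq.exists_bounds hp
  obtain ⟨n, hn⟩ := finLpNorm.exists_mul_lt hp (P.exponent_lt hη hηζ hζ) (D * 4)
  have h1 := (hbd n fun _ => 1).2
  have h2 := (hx.comp hφ).spreadingModel_upper he (hη.trans hηζ.le) hζ
    (fun k h1 h2 => (hα k h1 h2).comp hφ) n fun _ => 1
  have h3 := mul_le_mul_of_nonneg_left h2 hD.le
  linarith

/-- Were the index positive, some subsequence would have only spreading models dominating `ℓ_{p_k}`,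
and none of its subsequences could generate `ℓ_{p_{ξ₀}}`. -/
lemma IsNormalizedBlock.alphaIndexZero_of_generating (hx : P.IsNormalizedBlock u x)
    (h : ∀ φ : ℕ → ℕ, StrictMono φ → HasSubseqGeneratingLp (P.p P.ξ₀) (x ∘ φ)) {k : ℕ}
    (hk : 1 ≤ k) (hkξ : (k : ℕ∞) < P.ξ₀) : P.AlphaIndexZero k u := by
  by_contra hα
  obtain ⟨φ, hφ, δ, hδ, hlow⟩ := hx.exists_spreadingModel_lower hk hkξ hα
  obtain ⟨ψ, hψ, E, _, _, _, e, he, heq⟩ := h φ hφ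
  have hk' : (1 : ℕ∞) ≤ k := by exact_mod_cast hk
  obtain ⟨D, hD, hbd⟩ := heq.exists_bounds (P.one_le_exponent P.one_le_ξ₀ le_rfl)
  obtain ⟨n, hn⟩ := finLpNorm.exists_mul_lt (P.one_le_exponent hk' hkξ.le)
    (P.exponent_lt hk' hkξ le_rfl) (δ⁻¹ * D)
  have h1 := (hlow ψ hψ E e he n fun _ => 1).trans (hbd n fun _ => 1).1
  have h2 := mul_lt_mul_of_pos_left hn hδ
  rw [mul_assoc, mul_inv_cancel_left₀ hδ.ne'] at h2
  linarith

/-- The least index with positive `α` has both the lower and the upper estimate. -/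
lemma IsNormalizedBlock.exists_generating_of_alphaIndexPos (hx : P.IsNormalizedBlock u x) {k : ℕ}
    (hk : 1 ≤ k) (hkξ : (k : ℕ∞) < P.ξ₀) (hα : P.AlphaIndexPos k u) :
    ∃ k', 1 ≤ k' ∧ k' ≤ k ∧ P.AlphaIndexPos k' u ∧ HasSubseqGeneratingLp (P.p k') x := by
  classical
  have hex : ∃ k, 1 ≤ k ∧ P.AlphaIndexPos k u := ⟨k, hk, hα⟩
  have hle : Nat.find hex ≤ k := Nat.find_min' hex ⟨hk, hα⟩
  obtain ⟨h1, h2⟩ := Nat.find_spec hex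
  refine ⟨Nat.find hex, h1, hle, h2, ?_⟩
  exact hx.hasSubseqGeneratingLp_of_alphaIndexPos h1
    (lt_of_le_of_lt (by exact_mod_cast hle) hkξ) h2
    fun k' hk' hlt => not_not.mp fun h => Nat.find_min hex hlt ⟨hk', h⟩

end SpreadingModels

end SpaceData

theorem mainTheorem5 (P : SpaceData) (u : ℕ → P.C00) (x : ℕ → P.X)
    (hx : P.IsNormalizedBlock u x) :
    -- the sequence admits an `ℓ_{p_ζ}` spreading model for some `ζ ∈ [1, ξ₀]`
    (∃ ζ : ℕ∞, 1 ≤ ζ ∧ ζ ≤ P.ξ₀ ∧ HasSubseqGeneratingLp (P.p ζ) x) ∧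
    -- a.
    (∀ k : ℕ, 2 ≤ k → (k : ℕ∞) < P.ξ₀ →
      ((P.AlphaIndexPos k u ∧ ∀ k' : ℕ, 1 ≤ k' → k' < k → P.AlphaIndexZero k' u) ↔
        (HasSubseqGeneratingLp (P.p k) x ∧
          ∀ k' : ℕ, 1 ≤ k' → k' < k → ¬ HasSubseqGeneratingLp (P.p k') x))) ∧
    -- b.
    (P.AlphaIndexPos 1 u ↔ HasSubseqGeneratingLp (P.p 1) x) ∧
    -- c.
    ((∀ k : ℕ, 1 ≤ k → (k : ℕ∞) < P.ξ₀ → P.AlphaIndexZero k u) ↔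
      ∀ φ : ℕ → ℕ, StrictMono φ → HasSubseqGeneratingLp (P.p P.ξ₀) (x ∘ φ)) ∧
    -- the first condition of c. when `ξ₀ = k₀ + 1` is finite
    (∀ k₀ : ℕ, P.ξ₀ = (k₀ : ℕ∞) + 1 →
      ((∀ k : ℕ, 1 ≤ k → (k : ℕ∞) < P.ξ₀ → P.AlphaIndexZero k u) ↔ P.AlphaIndexZero k₀ u)) := by
  have h1ξ : ((1 : ℕ) : ℕ∞) < P.ξ₀ := lt_of_lt_of_le (by norm_num) P.two_le_ξ₀
  have hsucc : ∀ {k : ℕ}, (k : ℕ∞) < P.ξ₀ → ((k + 1 : ℕ) : ℕ∞) ≤ P.ξ₀ := fun h => by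
    push_cast
    exact Order.add_one_le_of_lt h
  -- If `α_{<k} = 0`, then `α_{<k'} = 0` for all `k' ≤ k` by monotonicity, so the upper estimate
  -- holds with `p_{k+1}` and excludes `ℓ_{p_k}`; `k + 1 ≤ ξ₀` even when `ξ₀` is finite.
  have hzero : ∀ {k : ℕ}, 1 ≤ k → (k : ℕ∞) < P.ξ₀ → HasSubseqGeneratingLp (P.p k) x →
      ¬ P.AlphaIndexZero k u := fun {k} hk hkξ hgen h =>
    hx.not_hasSubseqGeneratingLp (η := k) (ζ := (k + 1 : ℕ)) (by exact_mod_cast hk)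
      (by exact_mod_cast Nat.lt_succ_self k) (hsucc hkξ)
      (fun k' _ hk' => h.mono (Nat.lt_succ_iff.mp (by exact_mod_cast hk'))) hgen
  refine ⟨?_, fun k hk hkξ => ⟨fun ⟨h, h'⟩ => ⟨?_, fun k' h1 h2 => ?_⟩,
    fun ⟨h, h'⟩ => ⟨?_, fun k' h1 h2 => ?_⟩⟩, ⟨fun h => ?_, fun h => ?_⟩,
    ⟨fun h φ hφ => ?_, fun h k hk hkξ => ?_⟩, fun k₀ hk₀ => ⟨fun h => ?_, fun h k hk hkξ => ?_⟩⟩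
  · by_cases h : ∀ k : ℕ, 1 ≤ k → (k : ℕ∞) < P.ξ₀ → P.AlphaIndexZero k u
    · exact ⟨P.ξ₀, P.one_le_ξ₀, le_rfl, hx.hasSubseqGeneratingLp_of_alphaIndexZero h⟩
    · push Not at h
      obtain ⟨k, hk, hkξ, hα⟩ := h
      obtain ⟨k', h1, h2, -, h3⟩ := hx.exists_generating_of_alphaIndexPos hk hkξ hα
      exact ⟨k', by exact_mod_cast h1, le_trans (by exact_mod_cast h2) hkξ.le, h3⟩
  · exact hx.hasSubseqGeneratingLp_of_alphaIndexPos (by omega) hkξ h h'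
  · exact hx.not_hasSubseqGeneratingLp (η := k') (ζ := k) (by exact_mod_cast h1)
      (by exact_mod_cast h2) hkξ.le fun k'' h3 h4 => h' k'' h3 (by exact_mod_cast h4)
  · exact hzero (by omega) hkξ h
  · by_contra hα
    obtain ⟨k'', h3, h4, -, h5⟩ := hx.exists_generating_of_alphaIndexPos h1
      (lt_trans (by exact_mod_cast h2) hkξ) hα
    exact h' k'' h3 (by omega) h5
  · exact_mod_cast hx.hasSubseqGeneratingLp_of_alphaIndexPos le_rfl h1ξ h
      fun k' h1 h2 => absurd h2 (by omega)
  · exact hzero le_rfl h1ξ (by exact_mod_cast h)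
  · exact (hx.comp hφ).hasSubseqGeneratingLp_of_alphaIndexZero fun k h1 h2 => (h k h1 h2).comp hφ
  · exact hx.alphaIndexZero_of_generating h hk hkξ
  · have h2 := P.two_le_ξ₀
    rw [hk₀] at h2
    have h3 : 2 ≤ k₀ + 1 := by exact_mod_cast h2
    exact h k₀ (by omega) (by rw [hk₀]; exact_mod_cast Nat.lt_succ_self k₀)
  · rw [hk₀] at hkξ
    exact h.mono (Nat.lt_succ_iff.mp (by exact_mod_cast hkξ))
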